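/- Let $\Lambda_3=\{3/2\}$ and, for $N\ge 4$, let $\Lambda_N=\{x_k\}_{k\ge 0}$ with $x_0=0$ and $x_k=1+\frac{1}{N-1-x_{k-1}}$ for $k\ge 1$. Let $N\ge 3$ and let $x=b/d\in\Lambda_N$ in lowest terms ($b\ge 0$, $d\ge 1$). Let $P_0,\dots,P_{N-1}$ be orthogonal projections on $\mathbb C^d$ with $\sum_{\mu=0}^{N-1}P_\mu=x\,\mathbb I_d$, and put $\tilde E_{\mu,0}=P_\mu$, $\tilde E_{\mu,1}=\mathbb I_d-P_\mu$. Let $$|\Psi_{\mathrm S}\rangle=\frac1{\sqrt{d!}}\sum_{\sigma\in\mathfrak S_d}\operatorname{sign}(\sigma)\,|\sigma(0)\rangle\otimes\cdots\otimes|\sigma(d-1)\rangle\in(\mathbb C^d)^{\otimes d}$$ be the Slater state, and for $\boldsymbol a\in\{0,1\}^d$, $\boldsymbol\mu\in\{0,\dots,N-1\}^d$ let $$\tilde p(\boldsymbol a|\boldsymbol\mu)=\langle\Psi_{\mathrm S}|\tilde E_{\mu_0,a_0}\otimes\cdots\otimes\tilde E_{\mu_{d-1},a_{d-1}}|\Psi_{\mathrm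 S}\rangle .$$ Theorem. Let $\mathcal H_0,\dots,\mathcal H_{d-1}$ be finite-dimensional complex Hilbert spaces, $|\Psi\rangle\in\mathcal H_0\otimes\cdots\otimes\mathcal H_{d-1}$ a unit vector, and $\{E^{(k)}_{\mu,0},E^{(k)}_{\mu,1}\}$ ($0\le k<d$, $0\le\mu<N$) two-outcome POVMs on $\mathcal H_k$ (positive operators with $E^{(k)}_{\mu,0}+E^{(k)}_{\mu,1}=\mathbb I$) such that $\langle\Psi|E^{(0)}_{\mu_0,a_0}\otimes\cdots\otimes E^{(d-1)}_{\mu_{d-1},a_{d-1}}|\Psi\rangle=\tilde p(\boldsymbol a|\boldsymbol\mu)$ for all $\boldsymbol a,\boldsymbol\mu$. Let $\rho_k$ be the reduced density operator of $|\Psi\rangle\langle\Psi|$ on $\mathcal H_k$. (1) If every $\rho_k$ has full support $\mathcal H_k$, then all $E^{(k)}_{\mu,a}$ are orthogonal projections, and for each $k$ there are a finite-dimensional Hilbert space $\mathcal H_k'$ and a surjective linear isometry $V_k:\mathcal H_k\to\mathbb C^d\otimes\mathcal H_k'$ with $$V_kE^{(k)}_{\mu,a}V_k^*=\tilde E_{\mu,a}\otimes\mathbb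 I_{\mathcal H_k'}\qquad\text{for all }\mu,a;$$ in particular $E^{(k)}_{\mu,0}$ becomes $P_\mu\otimes\mathbb I_{\mathcal H_k'}$. (2) Without any assumption on the supports, for each $k$ the support of $\rho_k$ is invariant under all $E^{(k)}_{\mu,a}$, and the conclusion of (1) holds for the restrictions of the $E^{(k)}_{\mu,a}$ to the support of $\rho_k$ (in place of $\mathcal H_k$). -/

import Mathlib

open scoped TensorProduct

namespace SlaterSelfTest

universe u

section HilbertTensor

variable {n : ℕ} {H : Fin n → Type u} [∀ k, NormedAddCommGroup (H k)]
  [∀ k, InnerProductSpace ℂ (H k)] [∀ k, FiniteDimensional ℂ (H k)]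

/-- The product basis of `⨂ H k` built from orthonormal bases of the factors. -/
noncomputable def productBasis (H : Fin n → Type u) [∀ k, NormedAddCommGroup (H k)]
    [∀ k, InnerProductSpace ℂ (H k)] [∀ k, FiniteDimensional ℂ (H k)] :
    Module.Basis (∀ k, Fin (Module.finrank ℂ (H k))) ℂ (⨂[ℂ] k, H k) :=
  Basis.piTensorProduct fun k => (stdOrthonormalBasis ℂ (H k)).toBasis

/-- The inner product of the Hilbert space `⨂ H k` (conjugate-linear in the first argument).
By `tensorInner_tprod` it is the sesquilinear form with
`⟨⨂ v k, ⨂ w k⟩ = ∏ ⟨v k, w k⟩`, so it does not depend on the bases. -/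
noncomputable def tensorInner (x y : ⨂[ℂ] k, H k) : ℂ :=
  ∑ p, (starRingEnd ℂ) ((productBasis H).repr x p) * (productBasis H).repr y p

theorem tensorInner_add_right (x y z : ⨂[ℂ] k, H k) :
    tensorInner x (y + z) = tensorInner x y + tensorInner x z := by
  simp [tensorInner, mul_add, Finset.sum_add_distrib]

theorem tensorInner_smul_right (c : ℂ) (x y : ⨂[ℂ] k, H k) :
    tensorInner x (c • y) = c * tensorInner x y := by
  simp only [tensorInner, map_smul, Finsupp.smul_apply, smul_eq_mul, Finset.mul_sum]
  exact Finset.sum_congr rfl fun p _ => by ring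

theorem tensorInner_conj_symm (x y : ⨂[ℂ] k, H k) :
    (starRingEnd ℂ) (tensorInner y x) = tensorInner x y := by
  simp only [tensorInner, map_sum, map_mul, Complex.conj_conj]
  exact Finset.sum_congr rfl fun p _ => mul_comm _ _

theorem tensorInner_sum_right {ι : Type*} (s : Finset ι) (x : ⨂[ℂ] k, H k)
    (y : ι → ⨂[ℂ] k, H k) :
    tensorInner x (∑ i ∈ s, y i) = ∑ i ∈ s, tensorInner x (y i) := by
  classical
  induction s using Finset.induction_on with
  | empty => simp [tensorInner]
  | insert a s ha ih => simp [Finset.sum_insert ha, tensorInner_add_right, ih]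

theorem tensorInner_smul_left (c : ℂ) (x y : ⨂[ℂ] k, H k) :
    tensorInner (c • x) y = (starRingEnd ℂ) c * tensorInner x y := by
  rw [← tensorInner_conj_symm, tensorInner_smul_right, map_mul, tensorInner_conj_symm]

theorem tensorInner_sum_left {ι : Type*} (s : Finset ι) (x : ι → ⨂[ℂ] k, H k)
    (y : ⨂[ℂ] k, H k) :
    tensorInner (∑ i ∈ s, x i) y = ∑ i ∈ s, tensorInner (x i) y := by
  rw [← tensorInner_conj_symm, tensorInner_sum_right, map_sum]
  exact Finset.sum_congr rfl fun i _ => tensorInner_conj_symm _ _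

theorem tensorInner_tprod (v w : ∀ k, H k) :
    tensorInner (PiTensorProduct.tprod ℂ v) (PiTensorProduct.tprod ℂ w)
      = ∏ k, inner ℂ (v k) (w k) := by
  have h : ∀ k, inner ℂ (v k) (w k) = ∑ i, (starRingEnd ℂ)
      ((stdOrthonormalBasis ℂ (H k)).repr (v k) i) *
        (stdOrthonormalBasis ℂ (H k)).repr (w k) i := fun k => by
    rw [← (stdOrthonormalBasis ℂ (H k)).sum_inner_mul_inner (v k) (w k)]
    exact Finset.sum_congr rfl fun i _ => by
      simp [OrthonormalBasis.repr_apply_apply]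
  simp only [h, Finset.prod_univ_sum, Fintype.piFinset_univ]
  simp [tensorInner, productBasis, Finset.prod_mul_distrib]

/-- `A` acting on the `k`-th factor and the identity on all the others. -/
noncomputable def localOp (k : Fin n) (A : H k →ₗ[ℂ] H k) :
    (⨂[ℂ] j, H j) →ₗ[ℂ] (⨂[ℂ] j, H j) :=
  PiTensorProduct.map (Function.update (fun _ => LinearMap.id) k A)

/-- The operator `|v⟩⟨w|`. -/
noncomputable def ketBra {E : Type u} [NormedAddCommGroup E] [InnerProductSpace ℂ E] (v w : E) :
    E →ₗ[ℂ] E :=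
  (InnerProductSpace.rankOne ℂ v w : E →L[ℂ] E)

/-- The reduced density operator `ρ_k` of `|ψ⟩⟨ψ|` on the `k`-th factor (partial trace over all
other factors), through its matrix elements
`⟨b i, ρ_k v⟩ = ⟨ψ, (|v⟩⟨b i| on factor k) ψ⟩` in an orthonormal basis `b`; by
`trace_reducedState_mul`, `tr (ρ_k A) = ⟨ψ, (A on factor k) ψ⟩` for all `A`. -/
noncomputable def reducedState (ψ : ⨂[ℂ] j, H j) (k : Fin n) : H k →ₗ[ℂ] H k where
  toFun v := ∑ i, tensorInner ψ (localOp k (ketBra v (stdOrthonormalBasis ℂ (H k) i)) ψ) •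
    stdOrthonormalBasis ℂ (H k) i
  map_add' v w := by
    simp [localOp, ketBra, PiTensorProduct.map_update_add, tensorInner_add_right, add_smul,
      Finset.sum_add_distrib]
  map_smul' c v := by
    simp [localOp, ketBra, PiTensorProduct.map_update_smul, tensorInner_smul_right, mul_smul,
      Finset.smul_sum]

theorem trace_reducedState_mul (ψ : ⨂[ℂ] j, H j) (k : Fin n) (A : H k →ₗ[ℂ] H k) :
    LinearMap.trace ℂ (H k) (reducedState ψ k ∘ₗ A) = tensorInner ψ (localOp k A ψ) := by
  have hA : A = ∑ i, ketBra (A (stdOrthonormalBasis ℂ (H k) i)) (stdOrthonormalBasis ℂ (H k) i) := by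
    ext v
    conv_lhs => rw [← (stdOrthonormalBasis ℂ (H k)).sum_repr' v]
    simp [ketBra, LinearMap.sum_apply]
  have hL : localOp k A = ∑ i, localOp k
      (ketBra (A (stdOrthonormalBasis ℂ (H k) i)) (stdOrthonormalBasis ℂ (H k) i)) := by
    conv_lhs => rw [hA]
    exact (PiTensorProduct.mapMultilinear ℂ H H).map_update_sum Finset.univ k _ _
  rw [LinearMap.trace_eq_sum_inner _ (stdOrthonormalBasis ℂ (H k)), hL, LinearMap.sum_apply,
    tensorInner_sum_right]
  refine Finset.sum_congr rfl fun i _ => ?_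
  change inner ℂ (stdOrthonormalBasis ℂ (H k) i) (∑ j, tensorInner ψ (localOp k
    (ketBra (A (stdOrthonormalBasis ℂ (H k) i)) (stdOrthonormalBasis ℂ (H k) j)) ψ) •
      stdOrthonormalBasis ℂ (H k) j) = _
  rw [(stdOrthonormalBasis ℂ (H k)).orthonormal.inner_right_fintype]

/-- The support of the reduced density operator `ρ_k` (for a positive operator on a
finite-dimensional Hilbert space, its range). -/
noncomputable def localSupport (ψ : ⨂[ℂ] j, H j) (k : Fin n) : Submodule ℂ (H k) :=
  LinearMap.range (reducedState ψ k)

end HilbertTensor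

/-- A quantum strategy for `n` parties with finite-dimensional Hilbert spaces `H k`, each choosing
among `N` two-outcome POVMs `{E k μ 0, E k μ 1}`, on a shared pure state. -/
structure Strategy (n N : ℕ) (H : Fin n → Type u) [∀ k, NormedAddCommGroup (H k)]
    [∀ k, InnerProductSpace ℂ (H k)] [∀ k, FiniteDimensional ℂ (H k)] where
  state : ⨂[ℂ] k, H k
  state_norm : tensorInner state state = 1
  E : ∀ k : Fin n, Fin N → Fin 2 → (H k →ₗ[ℂ] H k)
  E_pos : ∀ k μ a, (E k μ a).IsPositive
  E_sum : ∀ k μ, E k μ 0 + E k μ 1 = LinearMap.id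

/-- `p(a | μ) = ⟨Ψ, (E 0 μ₀ a₀ ⊗ ⋯ ⊗ E (n-1) μₙ₋₁ aₙ₋₁) Ψ⟩`. -/
noncomputable def Strategy.correlation {n N : ℕ} {H : Fin n → Type u}
    [∀ k, NormedAddCommGroup (H k)] [∀ k, InnerProductSpace ℂ (H k)]
    [∀ k, FiniteDimensional ℂ (H k)] (S : Strategy n N H)
    (a : Fin n → Fin 2) (μ : Fin n → Fin N) : ℂ :=
  tensorInner S.state (PiTensorProduct.map (fun k => S.E k (μ k) (a k)) S.state)

/-- The `d`-party Slater state in `(ℂ^d)^{⊗ d}`. -/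
noncomputable def slaterState (d : ℕ) : ⨂[ℂ] _ : Fin d, EuclideanSpace ℂ (Fin d) :=
  ((1 / Real.sqrt (d.factorial) : ℝ) : ℂ) • ∑ σ : Equiv.Perm (Fin d),
    ((Equiv.Perm.sign σ : ℤ) : ℂ) •
      PiTensorProduct.tprod ℂ fun k => EuclideanSpace.single (σ k) (1 : ℂ)

theorem slaterState_norm (d : ℕ) : tensorInner (slaterState d) (slaterState d) = 1 := by
  have hprod : ∀ σ τ : Equiv.Perm (Fin d),
      (∏ k, inner ℂ (EuclideanSpace.single (σ k) (1 : ℂ)) (EuclideanSpace.single (τ k) (1 : ℂ)))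
        = if σ = τ then (1 : ℂ) else 0 := fun σ τ => by
    by_cases h : σ = τ
    · subst h
      simp
    · rw [if_neg h]
      obtain ⟨k, hk⟩ := not_forall.mp (mt Equiv.ext h)
      exact Finset.prod_eq_zero (Finset.mem_univ k) (by
        rw [EuclideanSpace.inner_single_left]
        simp [hk])
  have hsign : ∀ σ : Equiv.Perm (Fin d),
      ((Equiv.Perm.sign σ : ℤ) : ℂ) * ((Equiv.Perm.sign σ : ℤ) : ℂ) = 1 := fun σ => by
    rw [← Int.cast_mul, ← Units.val_mul, Int.units_mul_self, Units.val_one, Int.cast_one]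
  have hf : (0 : ℝ) < d.factorial := by exact_mod_cast d.factorial_pos
  simp only [slaterState, tensorInner_smul_left, tensorInner_smul_right, tensorInner_sum_left,
    tensorInner_sum_right, tensorInner_tprod, hprod, Complex.conj_ofReal, map_intCast,
    mul_ite, mul_one, mul_zero, Finset.sum_ite_eq', Finset.mem_univ, if_true]
  rw [Finset.sum_congr rfl fun σ _ => show _ = (((1 / Real.sqrt d.factorial : ℝ)) : ℂ) by
    rw [mul_left_comm, hsign, mul_one]]
  simp only [Finset.sum_const, Finset.card_univ, Fintype.card_perm, Fintype.card_fin,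
    nsmul_eq_mul]
  norm_cast
  rw [mul_left_comm, div_mul_div_comm, Real.mul_self_sqrt hf.le, one_mul,
    mul_one_div_cancel hf.ne']

/-- The canonical strategy: the Slater state, every party measuring `{P μ, 1 - P μ}`. -/
noncomputable def canonicalStrategy {d N : ℕ}
    (P : Fin N → (EuclideanSpace ℂ (Fin d) →ₗ[ℂ] EuclideanSpace ℂ (Fin d)))
    (hP : ∀ μ, (P μ).IsSymmetricProjection) :
    Strategy d N (fun _ => EuclideanSpace ℂ (Fin d)) where
  state := slaterState d
  state_norm := slaterState_norm d
  E _ μ := ![P μ, LinearMap.id - P μ]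
  E_pos _ μ a := by
    fin_cases a
    · exact (hP μ).isPositive
    · refine LinearMap.IsSymmetricProjection.isPositive ⟨?_, ?_⟩
      · exact (hP μ).isIdempotentElem.one_sub
      · exact LinearMap.IsSymmetric.id.sub (hP μ).isSymmetric
  E_sum _ μ := by simp

/-- The space `K` carries operators `A μ a` that are, up to a unitary `V : K → F ⊗ ℂ^m`, the
reference operators `B μ a` on `F` tensored with an identity: `V A V* = B ⊗ I`. -/
def EqTensorIdentity {N : ℕ} {K : Type u} {F : Type*} [NormedAddCommGroup K]
    [InnerProductSpace ℂ K] [NormedAddCommGroup F] [InnerProductSpace ℂ F]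
    (A : Fin N → Fin 2 → (K →ₗ[ℂ] K)) (B : Fin N → Fin 2 → (F →ₗ[ℂ] F)) : Prop :=
  ∃ (m : ℕ) (V : K ≃ₗᵢ[ℂ] F ⊗[ℂ] EuclideanSpace ℂ (Fin m)),
    ∀ μ a, V.toLinearEquiv.conj (A μ a) = TensorProduct.map (B μ a) LinearMap.id

/-- The recursion `x₀ = 0`, `x_k = 1 + 1 / (N - 1 - x_{k-1})`. -/
def lambdaSeq (N : ℕ) : ℕ → ℚ
  | 0 => 0
  | k + 1 => 1 + 1 / ((N : ℚ) - 1 - lambdaSeq N k)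

/-- `Λ_3 = {3/2}`, and `Λ_N = {x_k : k ≥ 0}` for `N ≥ 4` (only used for `N ≥ 3`). -/
def Lam (N : ℕ) : Set ℚ :=
  if N = 3 then {3 / 2} else Set.range (lambdaSeq N)

end SlaterSelfTest

/-! The argument has an operational half and a representation-theoretic half.

Operational half. The Slater state spans the top exterior power, on which the derivation `∑ k,
localOp k A` acts as the trace of `A`. Hence if all parties measure the same `μ`, exactly `r μ =
rank (P μ)` of them obtain `0` (`canonicalStrategy_hasZeroCount`). A vanishing probability kills the
corresponding vector, so in every strategy with these correlations the outcome of party `k` is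
predicted by the others: `E k μ 0` acts on the state as an operator on the other factors
(`Strategy.HasZeroCount.localOp_state`). Consequently it commutes with `ρ_k`, it is idempotent on
the support of `ρ_k`, and the Gram matrix of the vectors `E k μ 0 Ψ` consists of sums of
correlations. The relation `∑ μ, E k μ 0 Ψ = x Ψ` therefore carries over from the canonical strategy
(`Strategy.HasZeroCount.localOp_sum_state_eq`), and the support of `ρ_k` carries projections with
sum `x`.

Rigidity half. Membership of `x = b/d` in `Λ_N` enters only through `N (d² - b d) + b² = N`. For
projections `Q μ` on `W` with sum `x`, the maps `Δ_μ T = Q μ T - T P μ` are Hilbert–Schmidt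
self-adjoint with sum zero, which gives `2 d dim W ≤ ∑ rank Δ_μ + 2 dim Hom(P, Q)`
(`two_mul_finrank_le_intertwiners`). For `Q = P`, Schur's lemma forces every `P μ` to have rank
`b/N`; with these ranks, the same inequality forces `Hom(P, Q) ≠ 0` whenever `W ≠ 0`. So `W` is an
orthogonal sum of copies of `P`. -/

namespace SlaterSelfTest

universe u

/-! ### Algebra of operators acting on one tensor factor. -/

section LocalOperators

variable {n : ℕ} {H : Fin n → Type u} [∀ k, NormedAddCommGroup (H k)]
  [∀ k, InnerProductSpace ℂ (H k)]

theorem localOp_comp (k : Fin n) (A B : H k →ₗ[ℂ] H k) (x : ⨂[ℂ] j, H j) :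
    localOp k (A ∘ₗ B) x = localOp k A (localOp k B x) := by
  rw [localOp, localOp, localOp, ← LinearMap.comp_apply, ← PiTensorProduct.map_comp]
  congr 2
  ext j
  by_cases h : j = k
  · subst h; simp
  · simp [h]

theorem localOp_map_update (k : Fin n) (A : H k →ₗ[ℂ] H k) (B : ∀ j, H j →ₗ[ℂ] H j)
    (x : ⨂[ℂ] j, H j) :
    localOp k A (PiTensorProduct.map (Function.update B k LinearMap.id) x) =
      PiTensorProduct.map (Function.update B k A) x := by
  rw [localOp, ← LinearMap.comp_apply, ← PiTensorProduct.map_comp]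
  congr 2
  ext j
  by_cases h : j = k
  · subst h; simp
  · simp [h]

theorem map_update_localOp (k : Fin n) (A : H k →ₗ[ℂ] H k) (B : ∀ j, H j →ₗ[ℂ] H j)
    (x : ⨂[ℂ] j, H j) :
    PiTensorProduct.map (Function.update B k LinearMap.id) (localOp k A x) =
      PiTensorProduct.map (Function.update B k A) x := by
  rw [localOp, ← LinearMap.comp_apply, ← PiTensorProduct.map_comp]
  congr 2
  ext j
  by_cases h : j = k
  · subst h; simp
  · simp [h]

theorem localOp_id (k : Fin n) (x : ⨂[ℂ] j, H j) : localOp k LinearMap.id x = x := by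
  have : Function.update (fun j => (LinearMap.id : H j →ₗ[ℂ] H j)) k LinearMap.id
      = fun _ => LinearMap.id := by simp
  rw [localOp, this, PiTensorProduct.map_id, LinearMap.id_apply]

/-- `localOp k` as a linear map. -/
noncomputable def localOpₗ (k : Fin n) :
    (H k →ₗ[ℂ] H k) →ₗ[ℂ] (⨂[ℂ] j, H j) →ₗ[ℂ] (⨂[ℂ] j, H j) :=
  (PiTensorProduct.mapMultilinear ℂ H H).toLinearMap (fun _ => LinearMap.id) k

theorem localOpₗ_apply (k : Fin n) (A : H k →ₗ[ℂ] H k) : localOpₗ k A = localOp k A := rfl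

theorem localOp_smul (k : Fin n) (c : ℂ) (A : H k →ₗ[ℂ] H k) (x : ⨂[ℂ] j, H j) :
    localOp k (c • A) x = c • localOp k A x := by
  simp only [← localOpₗ_apply, map_smul, LinearMap.smul_apply]

theorem localOp_sum {ι : Type*} (s : Finset ι) (k : Fin n) (A : ι → (H k →ₗ[ℂ] H k))
    (x : ⨂[ℂ] j, H j) :
    localOp k (∑ i ∈ s, A i) x = ∑ i ∈ s, localOp k (A i) x := by
  simp only [← localOpₗ_apply, map_sum, LinearMap.sum_apply]

end LocalOperators

/-! ### Symmetric and positive product operators, and their relation to the reduced state. -/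

section TensorOperators

variable {n : ℕ} {H : Fin n → Type u} [∀ k, NormedAddCommGroup (H k)]
  [∀ k, InnerProductSpace ℂ (H k)] [∀ k, FiniteDimensional ℂ (H k)]

theorem tensorInner_add_left (x y z : ⨂[ℂ] k, H k) :
    tensorInner (x + y) z = tensorInner x z + tensorInner y z := by
  rw [← tensorInner_conj_symm, tensorInner_add_right, map_add, tensorInner_conj_symm,
    tensorInner_conj_symm]

theorem tensorInner_sub_left (x y z : ⨂[ℂ] k, H k) :
    tensorInner (x - y) z = tensorInner x z - tensorInner y z := by
  rw [sub_eq_add_neg, ← neg_one_smul ℂ y, tensorInner_add_left, tensorInner_smul_left]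
  simp [sub_eq_add_neg]

theorem tensorInner_sub_right (x y z : ⨂[ℂ] k, H k) :
    tensorInner x (y - z) = tensorInner x y - tensorInner x z := by
  rw [sub_eq_add_neg, ← neg_one_smul ℂ z, tensorInner_add_right, tensorInner_smul_right]
  simp [sub_eq_add_neg]

theorem tensorInner_zero_right (x : ⨂[ℂ] k, H k) : tensorInner x 0 = 0 := by
  simp [tensorInner]

theorem eq_zero_of_tensorInner_self {x : ⨂[ℂ] k, H k} (h : tensorInner x x = 0) : x = 0 := by
  have h' : ∑ p, Complex.normSq ((productBasis H).repr x p) = 0 := by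
    have : ((∑ p, Complex.normSq ((productBasis H).repr x p) : ℝ) : ℂ) = 0 := by
      rw [← h, tensorInner, Complex.ofReal_sum]
      exact Finset.sum_congr rfl fun p _ => Complex.normSq_eq_conj_mul_self
    exact_mod_cast this
  rw [Finset.sum_eq_zero_iff_of_nonneg fun p _ => Complex.normSq_nonneg _] at h'
  apply (productBasis H).repr.injective
  ext p
  simpa using h' p (Finset.mem_univ p)

/-- A product of symmetric operators is symmetric. -/
theorem tensorInner_map_left {A : ∀ k, H k →ₗ[ℂ] H k} (hA : ∀ k, (A k).IsSymmetric)
    (x y : ⨂[ℂ] k, H k) :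
    tensorInner (PiTensorProduct.map A x) y = tensorInner x (PiTensorProduct.map A y) := by
  induction x using PiTensorProduct.induction_on with
  | add x₁ x₂ h₁ h₂ => rw [map_add, tensorInner_add_left, tensorInner_add_left, h₁, h₂]
  | smul_tprod c v =>
    induction y using PiTensorProduct.induction_on with
    | add y₁ y₂ h₁ h₂ => rw [map_add, tensorInner_add_right, tensorInner_add_right, h₁, h₂]
    | smul_tprod c' w =>
      simp only [map_smul, PiTensorProduct.map_tprod, tensorInner_smul_left,
        tensorInner_smul_right, tensorInner_tprod]
      simp only [(hA _ _ _)]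

theorem tensorInner_localOp_left {k : Fin n} {A : H k →ₗ[ℂ] H k} (hA : A.IsSymmetric)
    (x y : ⨂[ℂ] j, H j) : tensorInner (localOp k A x) y = tensorInner x (localOp k A y) := by
  refine tensorInner_map_left (fun j => ?_) x y
  by_cases h : j = k
  · subst h; simpa using hA
  · simp only [ne_eq, h, not_false_eq_true, Function.update_of_ne]
    exact LinearMap.IsSymmetric.id

theorem inner_reducedState (ψ : ⨂[ℂ] j, H j) (k : Fin n) (v w : H k) :
    inner ℂ w (reducedState ψ k v) = tensorInner ψ (localOp k (ketBra v w) ψ) := by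
  have hw : ketBra v w = ∑ i, inner ℂ w (stdOrthonormalBasis ℂ (H k) i) •
      ketBra v (stdOrthonormalBasis ℂ (H k) i) := by
    ext y
    simp only [ketBra, LinearMap.sum_apply, LinearMap.smul_apply,
      ContinuousLinearMap.coe_coe, InnerProductSpace.rankOne_apply, smul_smul,
      ← Finset.sum_smul]
    rw [(stdOrthonormalBasis ℂ (H k)).sum_inner_mul_inner]
  rw [hw, localOp_sum, tensorInner_sum_right]
  simp only [localOp_smul, tensorInner_smul_right]
  change inner ℂ w (∑ i, tensorInner ψ (localOp k (ketBra v (stdOrthonormalBasis ℂ (H k) i)) ψ) •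
    stdOrthonormalBasis ℂ (H k) i) = _
  simp only [inner_sum, inner_smul_right]
  exact Finset.sum_congr rfl fun i _ => mul_comm _ _

theorem comp_ketBra {E : Type u} [NormedAddCommGroup E] [InnerProductSpace ℂ E]
    (A : E →ₗ[ℂ] E) (v w : E) : A ∘ₗ ketBra v w = ketBra (A v) w := by
  ext y; simp [ketBra]

theorem ketBra_comp {E : Type u} [NormedAddCommGroup E] [InnerProductSpace ℂ E]
    {A : E →ₗ[ℂ] E} (hA : A.IsSymmetric) (v w : E) : ketBra v w ∘ₗ A = ketBra v (A w) := by
  ext y; simp [ketBra, hA w y]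

/-- A symmetric operator whose action on `ψ` can be steered from the other factors commutes with
the reduced state. -/
theorem reducedState_commute {ψ : ⨂[ℂ] j, H j} {k : Fin n} {A : H k →ₗ[ℂ] H k}
    (hA : A.IsSymmetric) {F : (⨂[ℂ] j, H j) →ₗ[ℂ] (⨂[ℂ] j, H j)}
    (hF : ∀ x y, tensorInner (F x) y = tensorInner x (F y))
    (hFc : ∀ (B : H k →ₗ[ℂ] H k) x, F (localOp k B x) = localOp k B (F x))
    (h : localOp k A ψ = F ψ) (v : H k) :
    reducedState ψ k (A v) = A (reducedState ψ k v) := by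
  refine ext_inner_left ℂ fun w => ?_
  -- `A` stands left of `|v⟩⟨w|`; moved onto the bra `ψ` it becomes `F`, which passes through
  -- `|v⟩⟨w|` and turns back into `A` on the right.
  rw [← hA, inner_reducedState, inner_reducedState, ← comp_ketBra, ← ketBra_comp hA,
    localOp_comp, localOp_comp, ← tensorInner_localOp_left hA, h, hF, hFc]

/-- Identities on `ψ` transfer to the support of the reduced state, since `⟨w, A ρ v⟩ = ⟨ψ, |v⟩⟨w| A
ψ⟩`. -/
theorem apply_reducedState_eq {ψ : ⨂[ℂ] j, H j} {k : Fin n} {A B : H k →ₗ[ℂ] H k}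
    (hA : A.IsSymmetric) (hB : B.IsSymmetric) (h : localOp k A ψ = localOp k B ψ) (v : H k) :
    A (reducedState ψ k v) = B (reducedState ψ k v) := by
  refine ext_inner_left ℂ fun w => ?_
  rw [← hA, ← hB, inner_reducedState, inner_reducedState, ← ketBra_comp hA, ← ketBra_comp hB,
    localOp_comp, localOp_comp, h]

theorem _root_.LinearMap.IsPositive.exists_sqrt {E : Type*} [NormedAddCommGroup E]
    [InnerProductSpace ℂ E] [FiniteDimensional ℂ E] {T : E →ₗ[ℂ] E} (hT : T.IsPositive) :
    ∃ B : E →ₗ[ℂ] E, B.IsSymmetric ∧ B ∘ₗ B = T := by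
  have h0 : (0 : E →L[ℂ] E) ≤ T.toContinuousLinearMap := by
    rw [ContinuousLinearMap.nonneg_iff_isPositive]
    exact (LinearMap.isPositive_toContinuousLinearMap_iff T).2 hT
  have h1 := CFC.sqrt_mul_sqrt_self T.toContinuousLinearMap h0
  refine ⟨(CFC.sqrt T.toContinuousLinearMap : E →L[ℂ] E), ?_, ?_⟩
  · exact ((ContinuousLinearMap.nonneg_iff_isPositive _).1
      (CFC.sqrt_nonneg T.toContinuousLinearMap)).isSymmetric
  · ext v
    exact congrArg (fun S : E →L[ℂ] E => S v) h1

/-- Writing each `A k` as the square of a symmetric `B k` turns the pairing into the squared norm of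
`⨂ B k` applied to `ψ`. -/
theorem map_eq_zero_of_tensorInner_eq_zero {A : ∀ k, H k →ₗ[ℂ] H k}
    (hA : ∀ k, (A k).IsPositive) {ψ : ⨂[ℂ] k, H k}
    (h : tensorInner ψ (PiTensorProduct.map A ψ) = 0) : PiTensorProduct.map A ψ = 0 := by
  choose B hB hBA using fun k => (hA k).exists_sqrt
  have hm : PiTensorProduct.map A ψ = PiTensorProduct.map B (PiTensorProduct.map B ψ) := by
    rw [← LinearMap.comp_apply, ← PiTensorProduct.map_comp]
    simp only [hBA]
  rw [hm, ← tensorInner_map_left hB] at h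
  rw [hm, eq_zero_of_tensorInner_self h, map_zero]

end TensorOperators

/-! ### Prediction of one party's outcome by the others, and what the correlations determine. -/

section Steering

variable {n N : ℕ} {H : Fin n → Type u} [∀ k, NormedAddCommGroup (H k)]
  [∀ k, InnerProductSpace ℂ (H k)] [∀ k, FiniteDimensional ℂ (H k)]

/-- The number of parties with outcome `0`. -/
def zeroCount (a : Fin n → Fin 2) : ℕ := (Finset.univ.filter fun k => a k = 0).card

theorem zeroCount_update_one_ne {a : Fin n → Fin 2} {k : Fin n} (h : a k = 0) :
    zeroCount (Function.update a k 1) ≠ zeroCount a := by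
  refine (Finset.card_lt_card ((Finset.ssubset_iff_of_subset fun j hj => ?_).2 ⟨k, ?_, ?_⟩)).ne
  · simp only [Finset.mem_filter, Finset.mem_univ, true_and] at hj ⊢
    by_cases hjk : j = k
    · rw [hjk, h]
    · rwa [Function.update_of_ne hjk] at hj
  · simpa using h
  · simp

/-- When all parties measure `μ`, exactly `r μ` of them obtain the outcome `0`. -/
def Strategy.HasZeroCount (S : Strategy n N H) (r : Fin N → ℕ) : Prop :=
  ∀ μ a, zeroCount a ≠ r μ → S.correlation a (fun _ => μ) = 0

/-- The outcomes in which party `k` and `r - 1` of the others obtain `0`. -/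
def steeringOutcomes (r : ℕ) (k : Fin n) : Finset (Fin n → Fin 2) :=
  Finset.univ.filter fun a => a k = 0 ∧ zeroCount a = r

/-- The effect of the parties other than `k` that predicts the outcome `0` of party `k` for `μ`. -/
noncomputable def Strategy.steer (S : Strategy n N H) (r : Fin N → ℕ) (k : Fin n) (μ : Fin N) :
    (⨂[ℂ] j, H j) →ₗ[ℂ] (⨂[ℂ] j, H j) :=
  ∑ a ∈ steeringOutcomes (r μ) k,
    PiTensorProduct.map (Function.update (fun j => S.E j μ (a j)) k LinearMap.id)

theorem Strategy.tensorInner_steer_left (S : Strategy n N H) (r : Fin N → ℕ) (k : Fin n)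
    (μ : Fin N) (x y : ⨂[ℂ] j, H j) :
    tensorInner (S.steer r k μ x) y = tensorInner x (S.steer r k μ y) := by
  simp only [steer, LinearMap.sum_apply, tensorInner_sum_left, tensorInner_sum_right]
  refine Finset.sum_congr rfl fun a _ => tensorInner_map_left (fun j => ?_) x y
  by_cases h : j = k
  · subst h
    simp
  · simpa [h] using (S.E_pos j μ (a j)).isSymmetric

theorem Strategy.steer_localOp (S : Strategy n N H) (r : Fin N → ℕ) (k : Fin n)
    (μ : Fin N) (B : H k →ₗ[ℂ] H k) (x : ⨂[ℂ] j, H j) :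
    S.steer r k μ (localOp k B x) = localOp k B (S.steer r k μ x) := by
  simp only [steer, LinearMap.sum_apply, map_sum, map_update_localOp, localOp_map_update]

variable {S : Strategy n N H} {r : Fin N → ℕ}

theorem Strategy.HasZeroCount.map_state (h : S.HasZeroCount r) {μ : Fin N} {a : Fin n → Fin 2}
    (ha : zeroCount a ≠ r μ) : PiTensorProduct.map (fun j => S.E j μ (a j)) S.state = 0 :=
  map_eq_zero_of_tensorInner_eq_zero (fun j => S.E_pos j μ (a j)) (h μ a ha)

/-- Split the identity on factor `k` as `E 0 + E 1`: the outcome `1` would leave one zero too few,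
so that term vanishes. -/
theorem Strategy.HasZeroCount.map_update_id_state (h : S.HasZeroCount r) {μ : Fin N} {k : Fin n}
    {a : Fin n → Fin 2} (ha : a ∈ steeringOutcomes (r μ) k) :
    PiTensorProduct.map (Function.update (fun j => S.E j μ (a j)) k LinearMap.id) S.state =
      PiTensorProduct.map (fun j => S.E j μ (a j)) S.state := by
  obtain ⟨hk, hr⟩ := (Finset.mem_filter.1 ha).2
  have h0 : Function.update (fun j => S.E j μ (a j)) k (S.E k μ 0) = fun j => S.E j μ (a j) := by
    rw [← hk, Function.update_eq_self]
  have h1 : Function.update (fun j => S.E j μ (a j)) k (S.E k μ 1) =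
      fun j => S.E j μ (Function.update a k 1 j) := by
    ext j
    by_cases hj : j = k
    · subst hj; simp
    · simp [hj]
  rw [← S.E_sum k μ, PiTensorProduct.map_update_add, LinearMap.add_apply, h0, h1,
    h.map_state (a := Function.update a k 1) (hr.symm ▸ zeroCount_update_one_ne hk), add_zero]

/-- Each identity on another factor is expanded as `E 0 + E 1`; only outcomes with the right number
of zeros survive. -/
theorem Strategy.HasZeroCount.localOp_state_eq_sum (h : S.HasZeroCount r) (k : Fin n)
    (μ : Fin N) : localOp k (S.E k μ 0) S.state =
      ∑ a ∈ steeringOutcomes (r μ) k, PiTensorProduct.map (fun j => S.E j μ (a j)) S.state := by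
  classical
  have hE : Function.update (fun j => (LinearMap.id : H j →ₗ[ℂ] H j)) k (S.E k μ 0) =
      fun j => ∑ c ∈ (if j = k then {0} else Finset.univ), S.E j μ c := by
    ext j : 1
    by_cases hj : j = k
    · subst hj; simp
    · simp [hj, S.E_sum]
  have hsum := (PiTensorProduct.mapMultilinear ℂ H H).map_sum_finset (fun j c => S.E j μ c)
    (fun j => if j = k then {0} else Finset.univ)
  simp only [PiTensorProduct.mapMultilinear_apply] at hsum
  rw [localOp, hE, hsum, LinearMap.sum_apply]
  symm
  refine Finset.sum_subset (fun a ha => ?_) fun a ha ha' => h.map_state fun hr => ha' ?_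
  · obtain ⟨hk, -⟩ := (Finset.mem_filter.1 ha).2
    rw [Fintype.mem_piFinset]
    intro j
    by_cases hj : j = k
    · subst hj; simpa using hk
    · simp [hj]
  · have := Fintype.mem_piFinset.1 ha k
    simp only [if_true, Finset.mem_singleton] at this
    exact Finset.mem_filter.2 ⟨Finset.mem_univ _, this, hr⟩

theorem Strategy.HasZeroCount.localOp_state (h : S.HasZeroCount r) (k : Fin n) (μ : Fin N) :
    localOp k (S.E k μ 0) S.state = S.steer r k μ S.state := by
  rw [h.localOp_state_eq_sum, steer, LinearMap.sum_apply]
  exact Finset.sum_congr rfl fun a ha => (h.map_update_id_state ha).symm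

/-- Steering the inner effect to the other parties frees party `k` to measure `μ` while they measure
`ν`. A product of two effects of one party thus becomes a sum of genuine measurement operators. -/
theorem Strategy.HasZeroCount.localOp_localOp_state (h : S.HasZeroCount r) (k : Fin n)
    (μ ν : Fin N) : localOp k (S.E k μ 0) (localOp k (S.E k ν 0) S.state) =
      ∑ a ∈ steeringOutcomes (r ν) k, PiTensorProduct.map
        (fun j => S.E j (Function.update (fun _ => ν) k μ j) (a j)) S.state := by
  rw [h.localOp_state, steer, LinearMap.sum_apply, map_sum]
  refine Finset.sum_congr rfl fun a ha => ?_
  obtain ⟨hk, -⟩ := (Finset.mem_filter.1 ha).2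
  rw [localOp_map_update]
  congr 2
  ext j : 1
  by_cases hj : j = k
  · subst hj; simp [hk]
  · simp [hj]

theorem Strategy.HasZeroCount.localOp_idem_state (h : S.HasZeroCount r) (k : Fin n)
    (μ : Fin N) : localOp k (S.E k μ 0) (localOp k (S.E k μ 0) S.state) =
      localOp k (S.E k μ 0) S.state := by
  rw [h.localOp_localOp_state, h.localOp_state_eq_sum]
  simp

theorem Strategy.HasZeroCount.tensorInner_localOp_state (h : S.HasZeroCount r) (k : Fin n)
    (μ ν : Fin N) : tensorInner (localOp k (S.E k μ 0) S.state) (localOp k (S.E k ν 0) S.state) =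
      ∑ a ∈ steeringOutcomes (r ν) k, S.correlation a (Function.update (fun _ => ν) k μ) := by
  rw [tensorInner_localOp_left (S.E_pos k μ 0).isSymmetric, h.localOp_localOp_state,
    tensorInner_sum_right]
  rfl

theorem Strategy.HasZeroCount.tensorInner_state_localOp (h : S.HasZeroCount r) (k : Fin n)
    (μ : Fin N) : tensorInner S.state (localOp k (S.E k μ 0) S.state) =
      ∑ a ∈ steeringOutcomes (r μ) k, S.correlation a (fun _ => μ) := by
  rw [← h.localOp_idem_state, ← tensorInner_localOp_left (S.E_pos k μ 0).isSymmetric,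
    h.tensorInner_localOp_state]
  simp

/-- The correlations determine the norm of `(∑ μ, E μ - c) ψ`. -/
theorem Strategy.HasZeroCount.tensorInner_sum_sub (h : S.HasZeroCount r) (k : Fin n) (c : ℂ) :
    tensorInner (localOp k (∑ μ, S.E k μ 0) S.state - c • S.state)
        (localOp k (∑ μ, S.E k μ 0) S.state - c • S.state) =
      (∑ ν, ∑ μ, ∑ a ∈ steeringOutcomes (r ν) k,
          S.correlation a (Function.update (fun _ => ν) k μ)) -
        c * (∑ μ, ∑ a ∈ steeringOutcomes (r μ) k, S.correlation a (fun _ => μ)) -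
        (starRingEnd ℂ) c * ((∑ μ, ∑ a ∈ steeringOutcomes (r μ) k, S.correlation a (fun _ => μ))
          - c) := by
  have hl : ∀ μ, tensorInner (localOp k (S.E k μ 0) S.state) S.state =
      ∑ a ∈ steeringOutcomes (r μ) k, S.correlation a (fun _ => μ) := fun μ => by
    rw [tensorInner_localOp_left (S.E_pos k μ 0).isSymmetric, h.tensorInner_state_localOp]
  simp only [localOp_sum, tensorInner_sub_left, tensorInner_sub_right, tensorInner_sum_left,
    tensorInner_sum_right, tensorInner_smul_left, tensorInner_smul_right, S.state_norm, hl,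
    h.tensorInner_localOp_state, h.tensorInner_state_localOp, Finset.sum_sub_distrib,
    ← Finset.mul_sum]
  ring

/-- Linear relations between the effects on the state only depend on the correlations. -/
theorem Strategy.HasZeroCount.localOp_sum_state_eq {H' : Fin n → Type*}
    [∀ k, NormedAddCommGroup (H' k)] [∀ k, InnerProductSpace ℂ (H' k)]
    [∀ k, FiniteDimensional ℂ (H' k)] {S' : Strategy n N H'} (h : S.HasZeroCount r)
    (hS : ∀ a μ, S.correlation a μ = S'.correlation a μ) {k : Fin n} {c : ℂ}
    (h' : localOp k (∑ μ, S'.E k μ 0) S'.state = c • S'.state) :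
    localOp k (∑ μ, S.E k μ 0) S.state = c • S.state := by
  have hr' : S'.HasZeroCount r := fun μ a ha => (hS a _).symm.trans (h μ a ha)
  refine sub_eq_zero.1 (eq_zero_of_tensorInner_self ?_)
  rw [h.tensorInner_sum_sub]
  simp only [hS]
  -- The squared norm is one and the same expression in the correlations for both strategies, and it
  -- vanishes for `S'`.
  rw [← hr'.tensorInner_sum_sub, h', sub_self, tensorInner_zero_right]

end Steering

/-! ### The Slater state as an alternating tensor. -/

section Slater

variable {d : ℕ}

theorem slaterState_eq_alternatization (d : ℕ) :
    slaterState d = ((1 / Real.sqrt (d.factorial) : ℝ) : ℂ) •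
      MultilinearMap.alternatization
        (PiTensorProduct.tprod ℂ (s := fun _ : Fin d => EuclideanSpace ℂ (Fin d)))
        (fun k => EuclideanSpace.single k (1 : ℂ)) := by
  rw [slaterState, MultilinearMap.alternatization_apply]
  congr 1

/-- The derivation induced by `A` maps an alternating product `∧ v k` to the sum of the
`v 0 ∧ ⋯ ∧ A (v k) ∧ ⋯`. -/
theorem sum_localOp_alternatization {E : Type u} [NormedAddCommGroup E] [InnerProductSpace ℂ E]
    (A : E →ₗ[ℂ] E) (v : Fin d → E) :
    ∑ k, localOp k A
        (MultilinearMap.alternatization (PiTensorProduct.tprod ℂ (s := fun _ : Fin d => E)) v) =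
      ∑ k, MultilinearMap.alternatization (PiTensorProduct.tprod ℂ (s := fun _ : Fin d => E))
        (Function.update v k (A (v k))) := by
  simp only [MultilinearMap.alternatization_apply, map_sum, MultilinearMap.domDomCongr_apply]
  rw [Finset.sum_comm, Finset.sum_comm (s := Finset.univ (α := Fin d))]
  refine Finset.sum_congr rfl fun σ _ => ?_
  -- Tensor position `k` holds the vector `v (σ k)`, so the right-hand sum is reindexed by `σ`.
  rw [← Equiv.sum_comp σ fun k => Equiv.Perm.sign σ • PiTensorProduct.tprod ℂ
    fun i => Function.update v k (A (v k)) (σ i)]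
  refine Finset.sum_congr rfl fun k _ => ?_
  rw [Units.smul_def, Units.smul_def, map_zsmul, localOp, PiTensorProduct.map_tprod]
  congr 2
  ext1 j
  by_cases hj : j = k
  · subst hj; simp
  · simp [hj]

theorem sum_localOp_slaterState
    (A : EuclideanSpace ℂ (Fin d) →ₗ[ℂ] EuclideanSpace ℂ (Fin d)) :
    ∑ k, localOp k A (slaterState d) = LinearMap.trace ℂ _ A • slaterState d := by
  rw [slaterState_eq_alternatization]
  simp only [map_smul]
  rw [← Finset.smul_sum, sum_localOp_alternatization, smul_comm]
  congr 1
  rw [LinearMap.trace_eq_sum_inner A (EuclideanSpace.basisFun (Fin d) ℂ), Finset.sum_smul]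
  refine Finset.sum_congr rfl fun k _ => ?_
  set alt := MultilinearMap.alternatization
    (PiTensorProduct.tprod ℂ (s := fun _ : Fin d => EuclideanSpace ℂ (Fin d)))
  set e : Fin d → EuclideanSpace ℂ (Fin d) := fun k => EuclideanSpace.single k (1 : ℂ)
  have hA : A (e k) = ∑ j, inner ℂ (e j) (A (e k)) • e j := by
    simpa [e] using ((EuclideanSpace.basisFun (Fin d) ℂ).sum_repr' (A (e k))).symm
  -- Off-diagonal matrix entries produce a repeated basis vector, which the alternating map kills.
  rw [hA, AlternatingMap.map_update_sum, Finset.sum_eq_single k]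
  · rw [AlternatingMap.map_update_smul, Function.update_eq_self]
    simp [e]
  · intro j _ hj
    rw [AlternatingMap.map_update_smul, AlternatingMap.map_update_self _ _ hj.symm, smul_zero]
  · simp

/-- The operator `∑ k, localOp k (P μ)` commutes with the joint measurement `M`. It multiplies the
measured vector by the number of zeros, and the Slater state by the trace `r μ`; if these differ,
the measured vector is zero. -/
theorem canonicalStrategy_hasZeroCount {N : ℕ}
    (P : Fin N → (EuclideanSpace ℂ (Fin d) →ₗ[ℂ] EuclideanSpace ℂ (Fin d)))
    (hP : ∀ μ, (P μ).IsSymmetricProjection) {r : Fin N → ℕ}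
    (hr : ∀ μ, LinearMap.trace ℂ _ (P μ) = r μ) :
    (canonicalStrategy P hP).HasZeroCount r := by
  intro μ a ha
  set S := canonicalStrategy P hP
  set M := PiTensorProduct.map (fun k => S.E k μ (a k))
  have hM : ∀ k, localOp k (P μ) (M S.state) = if a k = 0 then M S.state else 0 := by
    intro k
    have h1 : localOp k (P μ) ∘ₗ M = PiTensorProduct.map
        (Function.update (fun k => S.E k μ (a k)) k (P μ ∘ₗ S.E k μ (a k))) := by
      rw [localOp, ← PiTensorProduct.map_comp]
      congr 1
      ext1 j
      by_cases h : j = k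
      · subst h; simp
      · simp [h]
    have hPP : P μ ∘ₗ P μ = P μ := (hP μ).isIdempotentElem
    rw [← LinearMap.comp_apply, h1]
    split_ifs with h
    · have h2 : P μ ∘ₗ S.E k μ (a k) = S.E k μ (a k) := by
        rw [h]; exact hPP
      rw [h2, Function.update_eq_self]
    · have h2 : P μ ∘ₗ S.E k μ (a k) = 0 := by
        rw [show a k = 1 by omega]
        change P μ ∘ₗ (LinearMap.id - P μ) = 0
        rw [LinearMap.comp_sub, hPP, LinearMap.comp_id, sub_self]
      rw [h2]
      have := (PiTensorProduct.mapMultilinear ℂ (fun _ : Fin d => EuclideanSpace ℂ (Fin d))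
        (fun _ : Fin d => EuclideanSpace ℂ (Fin d))).map_update_zero
          (fun k => S.E k μ (a k)) k
      rw [PiTensorProduct.mapMultilinear_apply] at this
      rw [this, LinearMap.zero_apply]
  have hc : ∀ k, localOp k (P μ) (M S.state) = M (localOp k (P μ) S.state) := by
    intro k
    simp only [localOp, M, ← LinearMap.comp_apply, ← PiTensorProduct.map_comp]
    congr 2
    ext1 j
    by_cases h : j = k
    · subst h
      have : ∀ c : Fin 2, P μ ∘ₗ S.E j μ c = S.E j μ c ∘ₗ P μ := by
        intro c
        fin_cases c
        · rfl
        · change P μ ∘ₗ (LinearMap.id - P μ) = (LinearMap.id - P μ) ∘ₗ P μ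
          rw [LinearMap.comp_sub, LinearMap.sub_comp, LinearMap.comp_id, LinearMap.id_comp]
      simpa using this _
    · simp [h]
  have h1 : ∑ k, localOp k (P μ) (M S.state) = (zeroCount a : ℂ) • M S.state := by
    simp only [hM]
    rw [← Finset.sum_filter, Finset.sum_const, zeroCount, Nat.cast_smul_eq_nsmul]
  have h2 : ∑ k, localOp k (P μ) (M S.state) = (r μ : ℂ) • M S.state := by
    simp only [hc]
    rw [← map_sum, ← hr μ, ← map_smul]
    exact congrArg M (sum_localOp_slaterState (P μ))
  have h3 : M S.state = 0 := by
    have : ((zeroCount a : ℂ) - r μ) • M S.state = 0 := by rw [sub_smul, ← h1, ← h2, sub_self]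
    refine (smul_eq_zero.1 this).resolve_left (sub_ne_zero.2 ?_)
    exact_mod_cast ha
  change tensorInner S.state (M S.state) = 0
  rw [h3, tensorInner_zero_right]

end Slater

/-! ### Projections with scalar sum and a lower bound for the space of intertwiners. -/

section Intertwiners

variable {N : ℕ} {V W : Type*} [NormedAddCommGroup V] [InnerProductSpace ℂ V]
  [FiniteDimensional ℂ V] [NormedAddCommGroup W] [InnerProductSpace ℂ W] [FiniteDimensional ℂ W]

/-- A family of orthogonal projections whose sum is the scalar `c`. -/
structure IsProjectionSum (Q : Fin N → (W →ₗ[ℂ] W)) (c : ℂ) : Prop where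
  proj : ∀ μ, (Q μ).IsSymmetricProjection
  sum_eq : ∑ μ, Q μ = c • LinearMap.id

omit [FiniteDimensional ℂ W] in
theorem IsProjectionSum.restrict {Q : Fin N → (W →ₗ[ℂ] W)} {c : ℂ} (hQ : IsProjectionSum Q c)
    {U : Submodule ℂ W} (hU : ∀ μ, ∀ v ∈ U, Q μ v ∈ U) :
    IsProjectionSum (fun μ => (Q μ).restrict (hU μ)) c where
  proj μ := by
    refine ⟨LinearMap.ext fun v => Subtype.ext ?_, fun v w => (hQ.proj μ).isSymmetric v w⟩
    exact LinearMap.congr_fun (hQ.proj μ).isIdempotentElem v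
  sum_eq := by
    ext v
    simpa [LinearMap.sum_apply] using LinearMap.congr_fun hQ.sum_eq v

theorem trace_eq_finrank_range {Q : W →ₗ[ℂ] W} (hQ : Q.IsSymmetricProjection) :
    LinearMap.trace ℂ W Q = Module.finrank ℂ (LinearMap.range Q) :=
  (LinearMap.IsIdempotentElem.isProj_range _ hQ.isIdempotentElem).trace

theorem IsProjectionSum.sum_finrank {Q : Fin N → (W →ₗ[ℂ] W)} {b d : ℕ} (hd : 0 < d)
    (hQ : IsProjectionSum Q ((b : ℂ) / d)) :
    d * ∑ μ, Module.finrank ℂ (LinearMap.range (Q μ)) = b * Module.finrank ℂ W := by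
  have h := congrArg (LinearMap.trace ℂ W) hQ.sum_eq
  simp only [map_sum, trace_eq_finrank_range (hQ.proj _), map_smul, LinearMap.trace_id,
    smul_eq_mul] at h
  have hd' : (d : ℂ) ≠ 0 := by exact_mod_cast hd.ne'
  have : (d : ℂ) * ∑ μ, (Module.finrank ℂ (LinearMap.range (Q μ)) : ℂ) =
      b * Module.finrank ℂ W := by
    rw [h]; field_simp
  exact_mod_cast this

/-- Integrality of the ranks does all the work: it rules out proper nonzero invariant subspaces in
dimension `d`. -/
theorem IsProjectionSum.dvd_finrank {Q : Fin N → (W →ₗ[ℂ] W)} {b d : ℕ} (hd : 0 < d)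
    (hbd : Nat.Coprime b d) (hQ : IsProjectionSum Q ((b : ℂ) / d)) :
    d ∣ Module.finrank ℂ W :=
  hbd.symm.dvd_of_dvd_mul_left ⟨_, (hQ.sum_finrank hd).symm⟩

/-- Schur's lemma in the smallest possible dimension. -/
theorem IsProjectionSum.eq_smul_id {P : Fin N → (V →ₗ[ℂ] V)} {b d : ℕ} (hd : 0 < d)
    (hbd : Nat.Coprime b d) (hP : IsProjectionSum P ((b : ℂ) / d))
    (hV : Module.finrank ℂ V = d) {X : V →ₗ[ℂ] V} (hX : ∀ μ, P μ ∘ₗ X = X ∘ₗ P μ) :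
    ∃ c : ℂ, X = c • LinearMap.id := by
  have : Nontrivial V := Module.nontrivial_of_finrank_pos (R := ℂ) (hV ▸ hd)
  obtain ⟨c, hc⟩ := Module.End.exists_eigenvalue (K := ℂ) X
  refine ⟨c, ?_⟩
  have hinv : ∀ μ, ∀ v ∈ Module.End.eigenspace X c, P μ v ∈ Module.End.eigenspace X c := by
    intro μ v hv
    rw [Module.End.mem_eigenspace_iff] at hv ⊢
    rw [← LinearMap.comp_apply, ← hX, LinearMap.comp_apply, hv, map_smul]
  have hdvd := (hP.restrict hinv).dvd_finrank hd hbd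
  have hpos : 0 < Module.finrank ℂ (Module.End.eigenspace X c) := by
    rw [Module.finrank_pos_iff, Submodule.nontrivial_iff_ne_bot]
    exact hc
  have htop : Module.End.eigenspace X c = ⊤ :=
    Submodule.eq_top_of_finrank_eq (le_antisymm (Submodule.finrank_le _)
      (hV ▸ Nat.le_of_dvd hpos hdvd))
  ext v
  exact Module.End.mem_eigenspace_iff.1 (htop ▸ Submodule.mem_top)

/-- If linear maps `Δ i` have sum zero, their ranks control the codimension of the intersection of
their kernels, provided that intersection is the kernel of `∑ i, Δ i ^ 2`. -/
theorem two_mul_finrank_le_sum_rank {M : Type*} [AddCommGroup M] [Module ℂ M]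
    [FiniteDimensional ℂ M] {ι : Type*} [Fintype ι] (Δ : ι → M →ₗ[ℂ] M) (hsum : ∑ i, Δ i = 0)
    (hker : LinearMap.ker (∑ i, Δ i ∘ₗ Δ i) ≤ ⨅ i, LinearMap.ker (Δ i)) :
    2 * Module.finrank ℂ M ≤ ∑ i, Module.finrank ℂ (LinearMap.range (Δ i)) +
      2 * Module.finrank ℂ (⨅ i, LinearMap.ker (Δ i) : Submodule ℂ M) := by
  -- The sum of the ranks is `dim ker S + dim range S`. The kernel contains the range of `φ`, the
  -- range contains that of `∑ i, Δ i ^ 2`, and each of these has at least the codimension of the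
  -- joint kernel as its dimension.
  let S : (∀ i, LinearMap.range (Δ i)) →ₗ[ℂ] M :=
    ∑ i, (LinearMap.range (Δ i)).subtype ∘ₗ LinearMap.proj i
  let φ : M →ₗ[ℂ] (∀ i, LinearMap.range (Δ i)) := LinearMap.pi fun i => (Δ i).rangeRestrict
  have hφ : LinearMap.ker φ = ⨅ i, LinearMap.ker (Δ i) := by
    simp only [φ, LinearMap.ker_pi, LinearMap.ker_rangeRestrict]
  have hSφ : LinearMap.range φ ≤ LinearMap.ker S := by
    rintro _ ⟨T, rfl⟩
    simpa [S, φ, LinearMap.sum_apply] using LinearMap.congr_fun hsum T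
  have hSr : LinearMap.range (∑ i, Δ i ∘ₗ Δ i) ≤ LinearMap.range S := by
    rintro _ ⟨T, rfl⟩
    refine ⟨fun i => ⟨Δ i (Δ i T), LinearMap.mem_range_self _ _⟩, ?_⟩
    simp [S, LinearMap.sum_apply]
  have h1 := S.finrank_range_add_finrank_ker
  have h2 := φ.finrank_range_add_finrank_ker
  have h3 := (∑ i, Δ i ∘ₗ Δ i).finrank_range_add_finrank_ker
  rw [Module.finrank_pi_fintype] at h1
  rw [hφ] at h2
  have h4 := Submodule.finrank_mono hSφ
  have h5 := Submodule.finrank_mono hSr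
  have h6 := Submodule.finrank_mono hker
  omega

/-- The map `T ↦ Q T - T P`. -/
def commDiff (P : V →ₗ[ℂ] V) (Q : W →ₗ[ℂ] W) : (V →ₗ[ℂ] W) →ₗ[ℂ] (V →ₗ[ℂ] W) where
  toFun T := Q ∘ₗ T - T ∘ₗ P
  map_add' S T := by
    rw [LinearMap.comp_add, LinearMap.add_comp]; abel
  map_smul' c T := by
    rw [LinearMap.comp_smul, LinearMap.smul_comp, RingHom.id_apply, smul_sub]

/-- The map `T ↦ A T B`. -/
def sandwich (B : V →ₗ[ℂ] V) (A : W →ₗ[ℂ] W) : (V →ₗ[ℂ] W) →ₗ[ℂ] (V →ₗ[ℂ] W) where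
  toFun T := A ∘ₗ T ∘ₗ B
  map_add' S T := by rw [LinearMap.add_comp, LinearMap.comp_add]
  map_smul' c T := by rw [LinearMap.smul_comp, LinearMap.comp_smul, RingHom.id_apply]

theorem finrank_range_sandwich_le (B : V →ₗ[ℂ] V) (A : W →ₗ[ℂ] W) :
    Module.finrank ℂ (LinearMap.range (sandwich B A)) ≤
      Module.finrank ℂ (LinearMap.range B) * Module.finrank ℂ (LinearMap.range A) := by
  let α : (LinearMap.range B →ₗ[ℂ] LinearMap.range A) →ₗ[ℂ] (V →ₗ[ℂ] W) :=
    { toFun := fun T => (LinearMap.range A).subtype ∘ₗ T ∘ₗ B.rangeRestrict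
      map_add' := fun S T => by rw [LinearMap.add_comp, LinearMap.comp_add]
      map_smul' := fun c T => by rw [LinearMap.smul_comp, LinearMap.comp_smul, RingHom.id_apply] }
  have h : LinearMap.range (sandwich B A) ≤ LinearMap.range α := by
    rintro _ ⟨T, rfl⟩
    exact ⟨A.rangeRestrict ∘ₗ T ∘ₗ (LinearMap.range B).subtype, rfl⟩
  rw [← Module.finrank_linearMap ℂ ℂ]
  exact (Submodule.finrank_mono h).trans (LinearMap.finrank_range_le α)

theorem finrank_range_id_sub {P : V →ₗ[ℂ] V} (hP : P.IsSymmetricProjection) :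
    Module.finrank ℂ (LinearMap.range (LinearMap.id - P)) +
      Module.finrank ℂ (LinearMap.range P) = Module.finrank ℂ V := by
  have hP' : (LinearMap.id - P).IsSymmetricProjection :=
    ⟨hP.isIdempotentElem.one_sub, LinearMap.IsSymmetric.id.sub hP.isSymmetric⟩
  have h := trace_eq_finrank_range hP'
  rw [map_sub, LinearMap.trace_id, trace_eq_finrank_range hP] at h
  have : (Module.finrank ℂ (LinearMap.range (LinearMap.id - P)) : ℂ) +
      Module.finrank ℂ (LinearMap.range P) = Module.finrank ℂ V := by rw [← h]; ring
  exact_mod_cast this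

theorem finrank_range_commDiff_le {P : V →ₗ[ℂ] V} {Q : W →ₗ[ℂ] W}
    (hP : P.IsSymmetricProjection) (hQ : Q.IsSymmetricProjection) :
    (Module.finrank ℂ (LinearMap.range (commDiff P Q)) : ℤ) ≤
      (Module.finrank ℂ V - Module.finrank ℂ (LinearMap.range P)) *
          Module.finrank ℂ (LinearMap.range Q) +
        Module.finrank ℂ (LinearMap.range P) *
          (Module.finrank ℂ W - Module.finrank ℂ (LinearMap.range Q)) := by
  have h : LinearMap.range (commDiff P Q) ≤ LinearMap.range (sandwich (LinearMap.id - P) Q) ⊔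
      LinearMap.range (sandwich P (LinearMap.id - Q)) := by
    rintro _ ⟨T, rfl⟩
    -- `Q T - T P = Q T (1 - P) - (1 - Q) T P`; the second sign explains `-T`.
    refine Submodule.mem_sup.2 ⟨_, ⟨T, rfl⟩, _, ⟨-T, rfl⟩, ?_⟩
    ext v
    simp [sandwich, commDiff]
  have h1 := (Submodule.finrank_mono h).trans (Submodule.finrank_add_le_finrank_add_finrank _ _)
  have h2 := finrank_range_sandwich_le (LinearMap.id - P) Q
  have h3 := finrank_range_sandwich_le P (LinearMap.id - Q)
  have hP' := finrank_range_id_sub hP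
  have hQ' := finrank_range_id_sub hQ
  zify at h1 h2 h3 hP' hQ'
  rw [← hP', ← hQ', add_sub_cancel_right, add_sub_cancel_right]
  linarith

/-- The Hilbert–Schmidt form `tr (X* Y)` is positive definite. -/
theorem eq_zero_of_trace_adjoint_comp_self {X : V →ₗ[ℂ] W}
    (h : (LinearMap.trace ℂ V (X.adjoint ∘ₗ X)).re ≤ 0) : X = 0 := by
  rw [LinearMap.trace_eq_sum_inner _ (stdOrthonormalBasis ℂ V), Complex.re_sum] at h
  have hi : ∀ v : V, (inner ℂ v ((X.adjoint ∘ₗ X) v)).re = ‖X v‖ ^ 2 := fun v => by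
    rw [LinearMap.comp_apply, LinearMap.adjoint_inner_right]
    exact inner_self_eq_norm_sq (𝕜 := ℂ) (X v)
  simp only [hi] at h
  have h0 := (Finset.sum_eq_zero_iff_of_nonneg fun i _ => sq_nonneg _).1
    (le_antisymm h (Finset.sum_nonneg fun i _ => sq_nonneg _))
  refine (stdOrthonormalBasis ℂ V).toBasis.ext fun i => ?_
  simpa using h0 i (Finset.mem_univ i)

/-- Self-adjointness of `commDiff P Q` for the Hilbert–Schmidt form. It makes `⟨T, ∑ Δ_μ² T⟩` a sum
of squared norms, which yields the kernel condition of `two_mul_finrank_le_sum_rank`. -/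
theorem trace_adjoint_comp_commDiff {P : V →ₗ[ℂ] V} {Q : W →ₗ[ℂ] W}
    (hP : P.IsSymmetric) (hQ : Q.IsSymmetric) (T X : V →ₗ[ℂ] W) :
    LinearMap.trace ℂ V (T.adjoint ∘ₗ commDiff P Q X) =
      LinearMap.trace ℂ V ((commDiff P Q T).adjoint ∘ₗ X) := by
  have hP' : P.adjoint = P := (LinearMap.isSymmetric_iff_isSelfAdjoint P).1 hP
  have hQ' : Q.adjoint = Q := (LinearMap.isSymmetric_iff_isSelfAdjoint Q).1 hQ
  change LinearMap.trace ℂ V (T.adjoint ∘ₗ (Q ∘ₗ X - X ∘ₗ P)) =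
    LinearMap.trace ℂ V ((Q ∘ₗ T - T ∘ₗ P).adjoint ∘ₗ X)
  rw [map_sub, LinearMap.adjoint_comp, LinearMap.adjoint_comp, hP', hQ', LinearMap.comp_sub,
    LinearMap.sub_comp, map_sub, map_sub, ← LinearMap.comp_assoc, ← LinearMap.comp_assoc,
    LinearMap.trace_comp_comm' P (T.adjoint ∘ₗ X), ← LinearMap.comp_assoc]

/-- The space of intertwiners between two families of operators. -/
def intertwiners (P : Fin N → (V →ₗ[ℂ] V)) (Q : Fin N → (W →ₗ[ℂ] W)) :
    Submodule ℂ (V →ₗ[ℂ] W) :=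
  ⨅ μ, LinearMap.ker (commDiff (P μ) (Q μ))

omit [FiniteDimensional ℂ V] [FiniteDimensional ℂ W] in
theorem mem_intertwiners {P : Fin N → (V →ₗ[ℂ] V)} {Q : Fin N → (W →ₗ[ℂ] W)} {T : V →ₗ[ℂ] W} :
    T ∈ intertwiners P Q ↔ ∀ μ, Q μ ∘ₗ T = T ∘ₗ P μ := by
  simp only [intertwiners, Submodule.mem_iInf, LinearMap.mem_ker]
  exact forall_congr' fun μ => sub_eq_zero

theorem two_mul_finrank_le_intertwiners {P : Fin N → (V →ₗ[ℂ] V)} {Q : Fin N → (W →ₗ[ℂ] W)}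
    {c : ℂ} (hP : IsProjectionSum P c) (hQ : IsProjectionSum Q c) :
    2 * (Module.finrank ℂ V * Module.finrank ℂ W : ℤ) ≤
      ∑ μ, ((Module.finrank ℂ V - Module.finrank ℂ (LinearMap.range (P μ))) *
          Module.finrank ℂ (LinearMap.range (Q μ)) +
        Module.finrank ℂ (LinearMap.range (P μ)) *
          (Module.finrank ℂ W - Module.finrank ℂ (LinearMap.range (Q μ))) : ℤ) +
      2 * Module.finrank ℂ (intertwiners P Q) := by
  have hsum : ∑ μ, commDiff (P μ) (Q μ) = 0 := by
    ext T v
    have h1 := LinearMap.congr_fun hQ.sum_eq (T v)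
    have h2 := congrArg T (LinearMap.congr_fun hP.sum_eq v)
    simp only [LinearMap.sum_apply, map_sum, LinearMap.smul_apply, map_smul,
      LinearMap.id_apply] at h1 h2
    simp [LinearMap.sum_apply, commDiff, Finset.sum_sub_distrib, h1, h2]
  have hker : LinearMap.ker (∑ μ, commDiff (P μ) (Q μ) ∘ₗ commDiff (P μ) (Q μ)) ≤
      ⨅ μ, LinearMap.ker (commDiff (P μ) (Q μ)) := by
    intro T hT
    rw [LinearMap.mem_ker] at hT
    have h1 : ∑ μ, (LinearMap.trace ℂ V ((commDiff (P μ) (Q μ) T).adjoint ∘ₗ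
        commDiff (P μ) (Q μ) T)).re = 0 := by
      have h := congrArg (fun X => (LinearMap.trace ℂ V
        (LinearMap.llcomp ℂ V W V T.adjoint X)).re) hT
      simp only [LinearMap.sum_apply, map_sum, Complex.re_sum, map_zero, Complex.zero_re] at h
      rw [← h]
      refine Finset.sum_congr rfl fun μ _ => congrArg Complex.re ?_
      exact (trace_adjoint_comp_commDiff (hP.proj μ).isSymmetric (hQ.proj μ).isSymmetric _ _).symm
    have h2 : ∀ X : V →ₗ[ℂ] W, 0 ≤ (LinearMap.trace ℂ V (X.adjoint ∘ₗ X)).re := fun X =>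
      (Complex.nonneg_iff.1 (LinearMap.isPositive_adjoint_comp_self X).trace_nonneg).1
    rw [Finset.sum_eq_zero_iff_of_nonneg fun μ _ => h2 _] at h1
    simp only [Submodule.mem_iInf, LinearMap.mem_ker]
    exact fun μ => eq_zero_of_trace_adjoint_comp_self (h1 μ (Finset.mem_univ μ)).le
  have h := two_mul_finrank_le_sum_rank _ hsum hker
  rw [Module.finrank_linearMap] at h
  zify at h
  refine h.trans (add_le_add_left (Finset.sum_le_sum fun μ _ => ?_) _)
  exact finrank_range_commDiff_le (hP.proj μ) (hQ.proj μ)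

end Intertwiners

/-! ### The quadratic equation satisfied by the elements of `Λ_N`. -/

section Arithmetic

/-- Every `lambdaSeq N k` is a fraction `b / d` with coprime `b` and `d` for which the quadratic
form `d ^ 2 - b d + b ^ 2 / N` takes the value `1`. -/
theorem lambdaSeq_eq_div {N : ℕ} (hN : 4 ≤ N) (k : ℕ) :
    ∃ b d : ℤ, 0 < d ∧ 0 ≤ b ∧ b ≤ 2 * d ∧ IsCoprime b d ∧ lambdaSeq N k = b / d ∧
      N * (d ^ 2 - b * d) + b ^ 2 = N := by
  have hN' : (4 : ℤ) ≤ N := by exact_mod_cast hN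
  induction k with
  | zero => exact ⟨0, 1, by simp [lambdaSeq, isCoprime_one_right]⟩
  | succ k ih =>
    obtain ⟨b, d, hd, hb, hbd, hc, hx, hq⟩ := ih
    -- The invariant `b ≤ 2 d` is carried for this: with `N ≥ 4` the new denominator is at least
    -- `d`.
    have hd' : 0 < (N - 1) * d - b := by nlinarith
    -- The recursion sends `b / d` to `(N d - b) / ((N - 1) d - b)`, a substitution of determinant
    -- `1` that preserves coprimality and the quadratic form.
    refine ⟨N * d - b, (N - 1) * d - b, hd', by nlinarith, by nlinarith, ?_, ?_, ?_⟩
    · obtain ⟨u, v, huv⟩ := hc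
      exact ⟨v + u * (N - 1), -v - u * N, by linear_combination huv⟩
    · have h1 : (d : ℚ) ≠ 0 := by exact_mod_cast hd.ne'
      have h2 : ((N : ℚ) - 1) * d - b ≠ 0 := by exact_mod_cast hd'.ne'
      have h3 : (N : ℚ) - 1 - b / d ≠ 0 := by
        rw [sub_div' h1]
        exact div_ne_zero h2 h1
      rw [lambdaSeq, hx]
      push_cast
      field_simp
      ring
    · linear_combination hq

theorem quadratic_eq_of_mem_Lam {N b d : ℕ} (hN : 3 ≤ N) (hd : 0 < d) (hbd : Nat.Coprime b d)
    (hx : (b : ℚ) / d ∈ Lam N) : (N * (d ^ 2 - b * d) + b ^ 2 : ℤ) = N := by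
  have key : ∀ b' d' : ℤ, 0 < d' → IsCoprime b' d' → (b : ℚ) / d = b' / d' →
      (b : ℤ) = b' ∧ (d : ℤ) = d' := by
    intro b' d' hd' hc h
    refine Rat.div_int_inj (by exact_mod_cast hd) hd' (by simpa using hbd)
      (Int.isCoprime_iff_gcd_eq_one.1 hc) ?_
    rwa [Int.cast_natCast, Int.cast_natCast]
  rcases Nat.lt_or_ge 3 N with h | h
  · rw [Lam, if_neg (by omega)] at hx
    obtain ⟨k, hk⟩ := hx
    obtain ⟨b', d', hd', -, -, hc, hx', hq⟩ := lambdaSeq_eq_div h k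
    obtain ⟨rfl, rfl⟩ := key b' d' hd' hc (hk.symm.trans hx')
    exact hq
  · obtain rfl : N = 3 := by omega
    rw [Lam, if_pos rfl, Set.mem_singleton_iff] at hx
    obtain ⟨h1, h2⟩ := key 3 2 (by norm_num) (by norm_num) (by rw [hx]; norm_num)
    rw [h1, h2]
    norm_num

end Arithmetic

/-! ### Every family of projections with sum `b / d` is a multiple of `P`. -/

section Rigidity

variable {N b d : ℕ} {V W : Type*} [NormedAddCommGroup V] [InnerProductSpace ℂ V]
  [FiniteDimensional ℂ V] [NormedAddCommGroup W] [InnerProductSpace ℂ W] [FiniteDimensional ℂ W]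
  {P : Fin N → (V →ₗ[ℂ] V)} {Q : Fin N → (W →ₗ[ℂ] W)}

theorem IsProjectionSum.finrank_range_eq (hd : 0 < d) (hbd : Nat.Coprime b d)
    (hq : (N * (d ^ 2 - b * d) + b ^ 2 : ℤ) = N) (hP : IsProjectionSum P ((b : ℂ) / d))
    (hV : Module.finrank ℂ V = d) (μ : Fin N) :
    N * Module.finrank ℂ (LinearMap.range (P μ)) = b := by
  have hle : Module.finrank ℂ (intertwiners P P) ≤ 1 := by
    have h : intertwiners P P ≤ Submodule.span ℂ {LinearMap.id} := fun T hT => by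
      obtain ⟨c, rfl⟩ := hP.eq_smul_id hd hbd hV (mem_intertwiners.1 hT)
      exact Submodule.smul_mem _ _ (Submodule.mem_span_singleton_self _)
    exact (Submodule.finrank_mono h).trans ((finrank_span_le_card _).trans (by simp))
  have h := two_mul_finrank_le_intertwiners hP hP
  have hs := hP.sum_finrank hd
  rw [hV, mul_comm b, Nat.mul_right_inj hd.ne'] at hs
  rw [hV] at h
  set p : Fin N → ℕ := fun μ => Module.finrank ℂ (LinearMap.range (P μ)) with hp
  have hs' : ∑ μ, (p μ : ℤ) = b := by exact_mod_cast hs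
  have h1 : ∑ μ, (((d : ℤ) - p μ) * p μ + p μ * ((d : ℤ) - p μ)) =
      2 * d * b - 2 * ∑ μ, (p μ : ℤ) ^ 2 := by
    rw [← hs', Finset.mul_sum, Finset.mul_sum, ← Finset.sum_sub_distrib]
    exact Finset.sum_congr rfl fun μ _ => by ring
  have h2 : ∑ μ, (p μ : ℤ) ^ 2 ≤ 1 - d ^ 2 + b * d := by
    have : (Module.finrank ℂ (intertwiners P P) : ℤ) ≤ 1 := by exact_mod_cast hle
    have h' : 2 * ((d : ℤ) * d) ≤ ∑ μ, (((d : ℤ) - p μ) * p μ + p μ * ((d : ℤ) - p μ)) +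
      2 * Module.finrank ℂ (intertwiners P P) := h
    rw [h1] at h'
    nlinarith
  have h3 : ∑ μ, ((N : ℤ) * p μ - b) ^ 2 = N * (N * ∑ μ, (p μ : ℤ) ^ 2 - b ^ 2) := by
    have : ∀ μ, ((N : ℤ) * p μ - b) ^ 2 = N ^ 2 * (p μ : ℤ) ^ 2 - 2 * N * b * p μ + b ^ 2 :=
      fun μ => by ring
    simp only [this, Finset.sum_add_distrib, Finset.sum_sub_distrib, ← Finset.mul_sum, hs',
      Finset.sum_const, Finset.card_univ, Fintype.card_fin, nsmul_eq_mul]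
    ring
  -- By `hq`, the bound in `h2` equals `b² / N`, the Cauchy–Schwarz minimum of `∑ p²` for ranks with
  -- sum `b`.
  have h4 : ∑ μ, ((N : ℤ) * p μ - b) ^ 2 ≤ 0 := by
    rw [h3]
    have := mul_le_mul_of_nonneg_left h2 (Int.natCast_nonneg N)
    exact mul_nonpos_of_nonneg_of_nonpos (Int.natCast_nonneg N) (by linarith)
  have h5 := (Finset.sum_eq_zero_iff_of_nonneg fun μ _ => sq_nonneg _).1
    (le_antisymm h4 (Finset.sum_nonneg fun μ _ => sq_nonneg _)) μ (Finset.mem_univ μ)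
  have h6 := sub_eq_zero.1 (pow_eq_zero_iff two_ne_zero |>.1 h5)
  exact_mod_cast h6

/-- Since the ranks of `P` are equal, the bound depends on the ranks of `Q` only through their sum,
which the trace fixes. Without intertwiners it would read `D (N (d² - b d) + b²) ≤ 0`, whereas the
left side is `D N`. -/
theorem IsProjectionSum.intertwiners_ne_bot (hN : 0 < N) (hd : 0 < d) (hbd : Nat.Coprime b d)
    (hq : (N * (d ^ 2 - b * d) + b ^ 2 : ℤ) = N) (hP : IsProjectionSum P ((b : ℂ) / d))
    (hV : Module.finrank ℂ V = d) (hQ : IsProjectionSum Q ((b : ℂ) / d)) [Nontrivial W] :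
    intertwiners P Q ≠ ⊥ := by
  intro hbot
  have h := two_mul_finrank_le_intertwiners hP hQ
  have hs := hQ.sum_finrank hd
  have hD : 0 < Module.finrank ℂ W := Module.finrank_pos
  rw [hbot, hV, finrank_bot] at h
  set D := Module.finrank ℂ W
  have hr : ∀ μ, (N : ℤ) * Module.finrank ℂ (LinearMap.range (P μ)) = b := fun μ => by
    exact_mod_cast hP.finrank_range_eq hd hbd hq hV μ
  set p : Fin N → ℕ := fun μ => Module.finrank ℂ (LinearMap.range (P μ))
  set q : Fin N → ℕ := fun μ => Module.finrank ℂ (LinearMap.range (Q μ))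
  have hs' : (d : ℤ) * ∑ μ, (q μ : ℤ) = b * D := by exact_mod_cast hs
  have h' : 2 * ((d : ℤ) * D) ≤ ∑ μ, (((d : ℤ) - p μ) * q μ + p μ * ((D : ℤ) - q μ)) := by
    simpa using h
  have h1 : (N : ℤ) * ∑ μ, (((d : ℤ) - p μ) * q μ + p μ * ((D : ℤ) - q μ)) =
      (N * d - 2 * b) * ∑ μ, (q μ : ℤ) + N * (b * D) := by
    have : ∀ μ, (N : ℤ) * (((d : ℤ) - p μ) * q μ + p μ * ((D : ℤ) - q μ)) =
        (N * d - 2 * b) * q μ + b * D := fun μ => by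
      linear_combination ((D : ℤ) - 2 * q μ) * hr μ
    rw [Finset.mul_sum]
    simp only [this, Finset.sum_add_distrib, ← Finset.mul_sum, Finset.sum_const,
      Finset.card_univ, Fintype.card_fin, nsmul_eq_mul]
    ring
  have h2 := mul_le_mul_of_nonneg_left h' (by positivity : (0 : ℤ) ≤ d * N)
  have h3 : (d : ℤ) * N * ∑ μ, (((d : ℤ) - p μ) * q μ + p μ * ((D : ℤ) - q μ)) =
      2 * (D * (N * b * d - b ^ 2)) := by
    rw [mul_assoc, h1]
    linear_combination ((N : ℤ) * d - 2 * b) * hs'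
  rw [h3] at h2
  have h4 : (0 : ℤ) < D * N := by positivity
  have h5 : (D * (N * (d ^ 2 - b * d) + b ^ 2) : ℤ) = D * N := by rw [hq]
  linarith

/-- Intertwiners from the irreducible family `P` are isometric up to a scalar. -/
theorem IsProjectionSum.inner_intertwiners (hd : 0 < d) (hbd : Nat.Coprime b d)
    (hP : IsProjectionSum P ((b : ℂ) / d)) (hV : Module.finrank ℂ V = d)
    (hQ : ∀ μ, (Q μ).IsSymmetric) {S T : V →ₗ[ℂ] W} (hS : S ∈ intertwiners P Q)
    (hT : T ∈ intertwiners P Q) {e : V} (he : ‖e‖ = 1) (v w : V) :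
    inner ℂ (S v) (T w) = inner ℂ (S e) (T e) * inner ℂ v w := by
  rw [mem_intertwiners] at hS hT
  -- `S* T` commutes with `P`, hence is a scalar, whose value is read off at the unit vector `e`.
  have hcomm : ∀ μ, P μ ∘ₗ (S.adjoint ∘ₗ T) = (S.adjoint ∘ₗ T) ∘ₗ P μ := by
    intro μ
    have hP' : (P μ).adjoint = P μ :=
      (LinearMap.isSymmetric_iff_isSelfAdjoint _).1 (hP.proj μ).isSymmetric
    have hQ' : (Q μ).adjoint = Q μ := (LinearMap.isSymmetric_iff_isSelfAdjoint _).1 (hQ μ)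
    have h := congrArg LinearMap.adjoint (hS μ)
    rw [LinearMap.adjoint_comp, LinearMap.adjoint_comp, hP', hQ'] at h
    rw [← LinearMap.comp_assoc, ← h, LinearMap.comp_assoc, hT, LinearMap.comp_assoc]
  obtain ⟨c, hc⟩ := hP.eq_smul_id hd hbd hV hcomm
  have h : ∀ v w : V, inner ℂ (S v) (T w) = c * inner ℂ v w := fun v w => by
    rw [← LinearMap.adjoint_inner_right, ← LinearMap.comp_apply, hc, LinearMap.smul_apply,
      inner_smul_right, LinearMap.id_apply]
  rw [h, h e e, inner_self_eq_norm_sq_to_K, he]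
  simp

/-- Evaluation at a unit vector embeds the intertwiners into `W`. An orthonormal basis of its image
gives isometric intertwiners `T j` with mutually orthogonal ranges, and these ranges exhaust `W`. -/
theorem IsProjectionSum.exists_orthonormalBasis (hN : 0 < N) (hd : 0 < d)
    (hbd : Nat.Coprime b d) (hq : (N * (d ^ 2 - b * d) + b ^ 2 : ℤ) = N)
    (hP : IsProjectionSum P ((b : ℂ) / d)) (hV : Module.finrank ℂ V = d)
    (hQ : IsProjectionSum Q ((b : ℂ) / d)) {ι : Type*} [Fintype ι]
    (β : OrthonormalBasis ι ℂ V) :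
    ∃ (m : ℕ) (T : Fin m → (V →ₗ[ℂ] W)) (γ : OrthonormalBasis (ι × Fin m) ℂ W),
      (∀ j, T j ∈ intertwiners P Q) ∧ ∀ i j, γ (i, j) = T j (β i) := by
  classical
  have hQs := fun μ => (hQ.proj μ).isSymmetric
  have : Nontrivial V := Module.nontrivial_of_finrank_pos (R := ℂ) (hV ▸ hd)
  obtain ⟨e, he⟩ := exists_norm_eq V zero_le_one
  let ev : intertwiners P Q →ₗ[ℂ] W := LinearMap.applyₗ e ∘ₗ (intertwiners P Q).subtype
  let u := stdOrthonormalBasis ℂ (LinearMap.range ev)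
  choose T hT using fun j => (u j).2
  have hin : ∀ j j' v w, inner ℂ ((T j : V →ₗ[ℂ] W) v) ((T j' : V →ₗ[ℂ] W) w) =
      if j = j' then inner ℂ v w else 0 := by
    intro j j' v w
    have h := orthonormal_iff_ite.1 u.orthonormal j j'
    rw [Submodule.coe_inner, ← hT, ← hT] at h
    rw [hP.inner_intertwiners hd hbd hV hQs (T j).2 (T j').2 he]
    change inner ℂ (ev (T j)) (ev (T j')) * _ = _
    rw [h, ite_mul, one_mul, zero_mul]
  let f : ι × Fin (Module.finrank ℂ (LinearMap.range ev)) → W :=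
    fun p => (T p.2 : V →ₗ[ℂ] W) (β p.1)
  have hf : Orthonormal ℂ f := by
    rw [orthonormal_iff_ite]
    rintro ⟨i, j⟩ ⟨i', j'⟩
    simp only [f, hin, orthonormal_iff_ite.1 β.orthonormal i i', Prod.mk.injEq]
    split_ifs <;> simp_all
  have hmem : ∀ j v, (T j : V →ₗ[ℂ] W) v ∈ Submodule.span ℂ (Set.range f) := by
    intro j v
    rw [← β.sum_repr v, map_sum]
    refine Submodule.sum_mem _ fun i _ => ?_
    rw [map_smul]
    exact Submodule.smul_mem _ _ (Submodule.subset_span ⟨(i, j), rfl⟩)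
  have horth : (Submodule.span ℂ (Set.range f))ᗮ = ⊥ := by
    by_contra hne
    set U := (Submodule.span ℂ (Set.range f))ᗮ with hU
    have hinv : ∀ μ, ∀ v ∈ U, Q μ v ∈ U := by
      intro μ v hv
      rw [hU, Submodule.mem_orthogonal] at hv ⊢
      intro w hw
      rw [← hQs μ]
      refine hv _ ?_
      induction hw using Submodule.span_induction with
      | mem x hx =>
        obtain ⟨⟨i, j⟩, rfl⟩ := hx
        have h := LinearMap.congr_fun (mem_intertwiners.1 (T j).2 μ) (β i)
        simp only [LinearMap.comp_apply] at h
        simp only [f, h]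
        exact hmem j _
      | zero => simp
      | add x y _ _ hx hy => rw [map_add]; exact Submodule.add_mem _ hx hy
      | smul c x _ hx => rw [map_smul]; exact Submodule.smul_mem _ c hx
    have : Nontrivial U := (Submodule.nontrivial_iff_ne_bot).2 hne
    obtain ⟨R, hR, hR0⟩ := Submodule.exists_mem_ne_zero_of_ne_bot
      (hP.intertwiners_ne_bot hN hd hbd hq hV (hQ.restrict hinv))
    -- An intertwiner into the complement `U` is also a combination of the `T j`, so its values lie
    -- both in the span and in its complement.
    let R' : intertwiners P Q := ⟨U.subtype ∘ₗ R, mem_intertwiners.2 fun μ => by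
      ext v
      exact congrArg Subtype.val (LinearMap.congr_fun (mem_intertwiners.1 hR μ) v)⟩
    have hsum : ev R' = ev (∑ j, u.repr ⟨ev R', LinearMap.mem_range_self _ _⟩ j • T j) := by
      have h := congrArg Subtype.val (u.sum_repr ⟨ev R', LinearMap.mem_range_self _ _⟩)
      simp only [Submodule.coe_sum, Submodule.coe_smul] at h
      simp only [map_sum, map_smul, hT]
      exact h.symm
    have hzero : ∀ X : intertwiners P Q, ev X = 0 → X = 0 := by
      intro X hX
      ext v
      have h := hP.inner_intertwiners hd hbd hV hQs X.2 X.2 he v v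
      change _ = inner ℂ (ev X) (ev X) * _ at h
      rw [hX, inner_zero_left, zero_mul, inner_self_eq_zero] at h
      simpa using h
    have hR' : R' = ∑ j, u.repr ⟨ev R', LinearMap.mem_range_self _ _⟩ j • T j :=
      sub_eq_zero.1 (hzero _ (by rw [map_sub, ← hsum, sub_self]))
    apply hR0
    ext v
    have h1 : (R v : W) ∈ Submodule.span ℂ (Set.range f) := by
      have h := congrArg (fun X : intertwiners P Q => (X : V →ₗ[ℂ] W) v) hR'
      simp only [Submodule.coe_sum, Submodule.coe_smul, LinearMap.sum_apply,
        LinearMap.smul_apply] at h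
      change (R v : W) = _ at h
      rw [h]
      exact Submodule.sum_mem _ fun j _ => Submodule.smul_mem _ _ (hmem j v)
    have h2 := (Submodule.mem_orthogonal _ _).1 (R v).2 _ h1
    simpa using h2
  refine ⟨_, fun j => T j, OrthonormalBasis.mkOfOrthogonalEqBot hf horth, fun j => (T j).2,
    fun i j => ?_⟩
  rw [OrthonormalBasis.coe_of_orthogonal_eq_bot_mk]

theorem eqTensorIdentity_of_isProjectionSum {K : Type u} [NormedAddCommGroup K]
    [InnerProductSpace ℂ K] [FiniteDimensional ℂ K] (hN : 0 < N) (hd : 0 < d)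
    (hbd : Nat.Coprime b d) (hq : (N * (d ^ 2 - b * d) + b ^ 2 : ℤ) = N)
    {A : Fin N → Fin 2 → (K →ₗ[ℂ] K)} {B : Fin N → Fin 2 → (V →ₗ[ℂ] V)}
    (hV : Module.finrank ℂ V = d)
    (hA : IsProjectionSum (fun μ => A μ 0) ((b : ℂ) / d))
    (hB : IsProjectionSum (fun μ => B μ 0) ((b : ℂ) / d))
    (hA1 : ∀ μ, A μ 0 + A μ 1 = LinearMap.id) (hB1 : ∀ μ, B μ 0 + B μ 1 = LinearMap.id) :
    EqTensorIdentity A B := by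
  let β := stdOrthonormalBasis ℂ V
  obtain ⟨m, T, γ, hT, hγ⟩ := hB.exists_orthonormalBasis hN hd hbd hq hV hA β
  let ε := EuclideanSpace.basisFun (Fin m) ℂ
  -- `U` sends `T j (β i)` to `β i ⊗ ε j`: the index `j` of the copy becomes the second tensor
  -- factor.
  let U := γ.equiv (β.tensorProduct ε) (Equiv.refl _)
  have hU : ∀ j v, U (T j v) = v ⊗ₜ ε j := by
    intro j v
    have h : U.toLinearEquiv.toLinearMap ∘ₗ T j = (TensorProduct.mk ℂ V _).flip (ε j) := by
      refine β.toBasis.ext fun i => ?_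
      have := γ.equiv_apply_basis (β.tensorProduct ε) (Equiv.refl _) (i, j)
      rw [hγ, Equiv.refl_apply, OrthonormalBasis.tensorProduct_apply] at this
      simpa using this
    exact LinearMap.congr_fun h v
  have hcomm : ∀ μ a, U.toLinearEquiv.toLinearMap ∘ₗ A μ a =
      TensorProduct.map (B μ a) LinearMap.id ∘ₗ U.toLinearEquiv.toLinearMap := by
    have h0 : ∀ μ, U.toLinearEquiv.toLinearMap ∘ₗ A μ 0 =
        TensorProduct.map (B μ 0) LinearMap.id ∘ₗ U.toLinearEquiv.toLinearMap := by
      intro μ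
      refine γ.toBasis.ext fun ⟨i, j⟩ => ?_
      have h := LinearMap.congr_fun (mem_intertwiners.1 (hT j) μ) (β i)
      simp only [LinearMap.comp_apply] at h
      simp [hγ, h, hU]
    intro μ a
    fin_cases a
    · exact h0 μ
    · have hA' : A μ 1 = LinearMap.id - A μ 0 := eq_sub_of_add_eq' (hA1 μ)
      have hB' : B μ 1 = LinearMap.id - B μ 0 := eq_sub_of_add_eq' (hB1 μ)
      change _ ∘ₗ A μ 1 = TensorProduct.map (B μ 1) _ ∘ₗ _
      have hsub := LinearMap.rTensor_sub (Q := EuclideanSpace ℂ (Fin m)) LinearMap.id (B μ 0)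
      rw [LinearMap.rTensor_id] at hsub
      change _ = LinearMap.rTensor _ _ ∘ₗ _
      rw [hA', hB', hsub, LinearMap.comp_sub, h0, LinearMap.sub_comp, LinearMap.comp_id,
        LinearMap.id_comp]
      rfl
  refine ⟨m, U, fun μ a => ?_⟩
  ext1
  ext v w
  have := LinearMap.congr_fun (hcomm μ a) (U.symm (v ⊗ₜ w))
  simpa [LinearEquiv.conj_apply] using this

end Rigidity

/-! ### The effects restricted to the support of the reduced state. -/

section Support

variable {n N : ℕ} {H : Fin n → Type u} [∀ k, NormedAddCommGroup (H k)]
  [∀ k, InnerProductSpace ℂ (H k)] [∀ k, FiniteDimensional ℂ (H k)]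
  {S : Strategy n N H} {r : Fin N → ℕ}

theorem Strategy.E_one_apply (S : Strategy n N H) (k : Fin n) (μ : Fin N) (v : H k) :
    S.E k μ 1 v = v - S.E k μ 0 v := by
  rw [eq_sub_of_add_eq' (S.E_sum k μ)]
  rfl

theorem Strategy.HasZeroCount.apply_mem_localSupport (h : S.HasZeroCount r) (k : Fin n)
    (μ : Fin N) (a : Fin 2) : ∀ v ∈ localSupport S.state k, S.E k μ a v ∈ localSupport S.state k := by
  have h0 : ∀ v ∈ localSupport S.state k, S.E k μ 0 v ∈ localSupport S.state k := by
    rintro _ ⟨v, rfl⟩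
    exact ⟨S.E k μ 0 v, reducedState_commute (S.E_pos k μ 0).isSymmetric
      (S.tensorInner_steer_left r k μ) (S.steer_localOp r k μ) (h.localOp_state k μ) v⟩
  intro v hv
  fin_cases a
  · exact h0 v hv
  · change S.E k μ 1 v ∈ _
    rw [S.E_one_apply]
    exact Submodule.sub_mem _ hv (h0 v hv)

theorem Strategy.HasZeroCount.idem_localSupport (h : S.HasZeroCount r) (k : Fin n) (μ : Fin N)
    (a : Fin 2) : ∀ v ∈ localSupport S.state k, S.E k μ a (S.E k μ a v) = S.E k μ a v := by
  have h0 : ∀ v ∈ localSupport S.state k, S.E k μ 0 (S.E k μ 0 v) = S.E k μ 0 v := by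
    rintro _ ⟨v, rfl⟩
    have hs := (S.E_pos k μ 0).isSymmetric
    have hss : (S.E k μ 0 ∘ₗ S.E k μ 0).IsSymmetric := fun x y => by
      rw [LinearMap.comp_apply, LinearMap.comp_apply, hs, hs]
    exact apply_reducedState_eq hss hs (by rw [localOp_comp, h.localOp_idem_state]) v
  intro v hv
  fin_cases a
  · exact h0 v hv
  · change S.E k μ 1 (S.E k μ 1 v) = S.E k μ 1 v
    rw [S.E_one_apply k μ v, S.E_one_apply, map_sub, h0 v hv, sub_self, sub_zero]

theorem Strategy.sum_localSupport (S : Strategy n N H) {k : Fin n} {c : ℝ}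
    (hc : localOp k (∑ μ, S.E k μ 0) S.state = (c : ℂ) • S.state) :
    ∀ v ∈ localSupport S.state k, ∑ μ, S.E k μ 0 v = (c : ℂ) • v := by
  rintro _ ⟨v, rfl⟩
  have hs : (∑ μ, S.E k μ 0).IsSymmetric := fun x y => by
    simp only [LinearMap.sum_apply, sum_inner, inner_sum, (S.E_pos k _ 0).isSymmetric x y]
  have hs' : ((c : ℂ) • LinearMap.id : H k →ₗ[ℂ] H k).IsSymmetric := fun x y => by
    simp only [LinearMap.smul_apply, LinearMap.id_apply, inner_smul_left, inner_smul_right,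
      Complex.conj_ofReal]
  rw [← LinearMap.sum_apply]
  exact apply_reducedState_eq hs hs' (by rw [localOp_smul, localOp_id, hc]) v

theorem canonicalStrategy_localOp_sum {d : ℕ} {c : ℂ}
    {P : Fin N → (EuclideanSpace ℂ (Fin d) →ₗ[ℂ] EuclideanSpace ℂ (Fin d))}
    (hP : ∀ μ, (P μ).IsSymmetricProjection) (hPsum : ∑ μ, P μ = c • LinearMap.id) (k : Fin d) :
    localOp k (∑ μ, (canonicalStrategy P hP).E k μ 0) (canonicalStrategy P hP).state =
      c • (canonicalStrategy P hP).state := by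
  have h : ∑ μ, (canonicalStrategy P hP).E k μ 0 = c • LinearMap.id := hPsum
  rw [h, localOp_smul, localOp_id]

end Support

end SlaterSelfTest

/-! ### The self-testing theorem. -/

theorem mainTheorem1 {N d b : ℕ} (hN : 3 ≤ N) (hd : 0 < d) (hbd : Nat.Coprime b d)
    (hx : (b : ℚ) / d ∈ SlaterSelfTest.Lam N)
    (P : Fin N → (EuclideanSpace ℂ (Fin d) →ₗ[ℂ] EuclideanSpace ℂ (Fin d)))
    (hP : ∀ μ, (P μ).IsSymmetricProjection)
    (hPsum : ∑ μ, P μ = ((b : ℂ) / (d : ℂ)) • LinearMap.id)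
    (H : Fin d → Type*) [∀ k, NormedAddCommGroup (H k)]
    [∀ k, InnerProductSpace ℂ (H k)] [∀ k, FiniteDimensional ℂ (H k)]
    (S : SlaterSelfTest.Strategy d N H)
    (hS : ∀ a μ, S.correlation a μ = (SlaterSelfTest.canonicalStrategy P hP).correlation a μ) :
    -- states whose reduced density operators have full support
    ((∀ k, SlaterSelfTest.localSupport S.state k = ⊤) →
      (∀ k μ a, (S.E k μ a).IsSymmetricProjection) ∧
      ∀ k, SlaterSelfTest.EqTensorIdentity (S.E k)
        ((SlaterSelfTest.canonicalStrategy P hP).E k)) ∧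
    -- arbitrary states: the same on the supports of the reduced density operators
    (∀ k, ∃ hinv : ∀ μ a, ∀ v ∈ SlaterSelfTest.localSupport S.state k,
        S.E k μ a v ∈ SlaterSelfTest.localSupport S.state k,
      (∀ μ a, ((S.E k μ a).restrict (hinv μ a)).IsSymmetricProjection) ∧
      SlaterSelfTest.EqTensorIdentity (fun μ a => (S.E k μ a).restrict (hinv μ a))
        ((SlaterSelfTest.canonicalStrategy P hP).E k)) := by
  open SlaterSelfTest in
  have hq := quadratic_eq_of_mem_Lam hN hd hbd hx
  have hr := canonicalStrategy_hasZeroCount P hP fun μ => trace_eq_finrank_range (hP μ)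
  have hSr : S.HasZeroCount _ := fun μ a ha => (hS a _).trans (hr μ a ha)
  -- `Strategy.sum_localSupport` takes a real scalar, so that its multiple of the identity is
  -- symmetric.
  have hcast : (((b : ℝ) / d : ℝ) : ℂ) = (b : ℂ) / d := by push_cast; rfl
  have hc : ∀ k, ∀ v ∈ localSupport S.state k, ∑ μ, S.E k μ 0 v = ((b : ℂ) / d) • v := by
    intro k
    have h := hSr.localOp_sum_state_eq (S' := canonicalStrategy P hP) hS (k := k)
      (canonicalStrategy_localOp_sum hP hPsum k)
    rw [← hcast] at h ⊢
    exact S.sum_localSupport h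
  have hN0 : 0 < N := by omega
  have hB : ∀ k, IsProjectionSum (fun μ => (canonicalStrategy P hP).E k μ 0) ((b : ℂ) / d) :=
    fun _ => ⟨hP, hPsum⟩
  refine ⟨fun htop => ?_, fun k => ⟨fun μ a => hSr.apply_mem_localSupport k μ a, ?_, ?_⟩⟩
  · have hmem : ∀ k v, v ∈ localSupport S.state k := fun k v => htop k ▸ Submodule.mem_top
    have hproj : ∀ k μ a, (S.E k μ a).IsSymmetricProjection := fun k μ a =>
      ⟨LinearMap.ext fun v => hSr.idem_localSupport k μ a v (hmem k v),
        (S.E_pos k μ a).isSymmetric⟩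
    refine ⟨hproj, fun k => eqTensorIdentity_of_isProjectionSum hN0 hd hbd hq
      finrank_euclideanSpace_fin ⟨fun μ => hproj k μ 0, ?_⟩ (hB k) (S.E_sum k)
      ((canonicalStrategy P hP).E_sum k)⟩
    ext v
    simpa [LinearMap.sum_apply] using hc k v (hmem k v)
  all_goals
    have hproj : ∀ μ a, ((S.E k μ a).restrict
        (hSr.apply_mem_localSupport k μ a)).IsSymmetricProjection := fun μ a =>
      ⟨LinearMap.ext fun v => Subtype.ext (hSr.idem_localSupport k μ a v v.2),
        fun v w => (S.E_pos k μ a).isSymmetric v w⟩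
  · exact hproj
  · refine eqTensorIdentity_of_isProjectionSum hN0 hd hbd hq
      finrank_euclideanSpace_fin ⟨fun μ => hproj μ 0, ?_⟩ (hB k) (fun μ => ?_)
      ((canonicalStrategy P hP).E_sum k)
    · ext v
      simpa [LinearMap.sum_apply] using hc k v v.2
    · ext v
      exact LinearMap.congr_fun (S.E_sum k μ) v
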